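/- Let $q\in(-1,1)$, put $a_q:=2/\sqrt{1-q}$, $(a;q)_\infty:=\prod_{k=0}^\infty(1-aq^k)$ and, for $x,y\in[-a_q,a_q]$ and $0\le s<t$, \[ p(x)=\frac{\sqrt{1-q}\,(q;q)_\infty}{2\pi}\sqrt{4-(1-q)x^2}\prod_{k=1}^\infty\big[(1+q^k)^2-(1-q)x^2q^k\big],\qquad p_{s,t}(x,y)=(e^{-2(t-s)};q)_\infty\prod_{k=0}^\infty\frac1{\varphi_{k}(t-s,x,y)}\;p(y), \] \[ \varphi_{k}(\delta,x,y)=(1-e^{-2\delta}q^{2k})^2-(1-q)e^{-\delta}q^k(1+e^{-2\delta}q^{2k})xy+(1-q)e^{-2\delta}q^{2k}(x^2+y^2). \] A $q$-Ornstein--Uhlenbeck process is a Markov process $X=(X_t)_{t\ge0}$ with càdlàg paths, all of whose marginals have density $p$ on $[-a_q,a_q]$ and whose transition densities are $p_{s,t}$. For $\epsilon>0$ and $i=1,2,\dots$ let $J_i(\epsilon)$ be the indicator of the event that there is $t\in(i-1,i]$ with $X_{t-}<-a_q+\epsilon$ and $X_t>a_q-\epsilon$; let $\mathcal J_1=\sigma(J_1(\epsilon))$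 and $\mathcal J_m^\infty=\sigma(J_k(\epsilon):k\ge m)$. There is a constant $C_q<\infty$, depending only on $q$, such that \[ \Big|\frac{p_{0,t}(x,y)}{p(y)}-1\Big|\le C_qe^{-t}\qquad\text{for all } t\ge1,\ x,y\in(-a_q,a_q), \] and such that, for every $q$-Ornstein--Uhlenbeck process $X$, the sequence $(J_i(\epsilon))_{i\ge1}$ is $\psi$-mixing in the sense that, almost surely, \[ |\mathbb P(B\mid\mathcal J_1)-\mathbb P(B)|\le C_qe^{-m}\,\mathbb P(B)\qquad\text{for all } B\in\mathcal J_{m+1}^\infty, \] for all integers $m\ge1$ and all $0<\epsilon<a_q$, and also for all $m\ge2$ and all $\epsilon\ge a_q$. -/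

import Mathlib

open MeasureTheory Filter Topology
open scoped NNReal

noncomputable section

namespace QOU

/-- The `q`-Pochhammer symbol `(a; q)_∞ = ∏_{k ≥ 0} (1 - a q ^ k)`. -/
def qPoch (a q : ℝ) : ℝ := ∏' k : ℕ, (1 - a * q ^ k)

/-- The right end point `2 / √(1 - q)` of the domain. -/
def endpt (q : ℝ) : ℝ := 2 / √(1 - q)

/-- The marginal density. The product over `k ≥ 1` is indexed by `k + 1`, `k : ℕ`.
Outside the domain `[-endpt q, endpt q]` the square root, hence the density, vanishes. -/
def dens (q x : ℝ) : ℝ :=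
  √(1 - q) * qPoch q q / (2 * Real.pi) * √(4 - (1 - q) * x ^ 2) *
    ∏' k : ℕ, ((1 + q ^ (k + 1)) ^ 2 - (1 - q) * x ^ 2 * q ^ (k + 1))

/-- The factors `φ_{q,k}(δ, x, y)` of the transition density. -/
def phi (q : ℝ) (k : ℕ) (δ x y : ℝ) : ℝ :=
  (1 - Real.exp (-2 * δ) * q ^ (2 * k)) ^ 2
    - (1 - q) * Real.exp (-δ) * q ^ k * (1 + Real.exp (-2 * δ) * q ^ (2 * k)) * x * y
    + (1 - q) * Real.exp (-2 * δ) * q ^ (2 * k) * (x ^ 2 + y ^ 2)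

/-- The transition density `p_{s,t}(x, y)`, for `s < t`. -/
def transDens (q s t x y : ℝ) : ℝ :=
  qPoch (Real.exp (-2 * (t - s))) q * (∏' k : ℕ, 1 / phi q k (t - s) x y) * dens q y

/-- Right-continuous functions with left limits on `[0, ∞)`. -/
def IsCadlag (f : ℝ≥0 → ℝ) : Prop :=
  ∀ t, ContinuousWithinAt f (Set.Ici t) t ∧ ∃ l, Tendsto f (𝓝[<] t) (𝓝 l)

/-- `X` is a `q`-Ornstein--Uhlenbeck process with paths in `D([0, ∞))`: every `X t` has the
density `dens q`, and `X` is Markov (with respect to its own past) with transition densities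
`transDens q s t`. -/
structure IsQOUProcess {Ω : Type*} [MeasurableSpace Ω] (q : ℝ) (X : ℝ≥0 → Ω → ℝ)
    (μ : Measure Ω) : Prop where
  measurable : ∀ t, Measurable (X t)
  cadlag : ∀ ω, IsCadlag (fun t => X t ω)
  marginal : ∀ t, μ.map (X t) = volume.withDensity (fun x => ENNReal.ofReal (dens q x))
  markov : ∀ s t : ℝ≥0, s < t → ∀ A : Set ℝ, MeasurableSet A →
    μ[(X t ⁻¹' A).indicator (fun _ => (1 : ℝ)) |
        ⨆ u ∈ Set.Iic s, MeasurableSpace.comap (X u) inferInstance]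
      =ᵐ[μ] fun ω => ∫ y in A, transDens q s t (X s ω) y

variable {Ω : Type*}

/-- The number `N((a, b], ε)` of big upward jumps in `(a, b]`, possibly infinite. -/
def bigJumps (q : ℝ) (X : ℝ≥0 → Ω → ℝ) (ε : ℝ) (a b : ℝ≥0) (ω : Ω) : ℕ∞ :=
  Set.encard {t ∈ Set.Ioc a b |
    Function.leftLim (fun s => X s ω) t < -endpt q + ε ∧ endpt q - ε < X t ω}

/-- The indicator `J_i(ε)` of at least one big jump in `(i - 1, i]`, for `i ≥ 1`. -/
def jumpInd (q : ℝ) (X : ℝ≥0 → Ω → ℝ) (ε : ℝ) (i : ℕ) : Ω → ℝ :=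
  {ω | 1 ≤ bigJumps q X ε ((i : ℝ≥0) - 1) i ω}.indicator (fun _ => 1)

/-- The σ-algebra generated by `J_1(ε)`. -/
abbrev sigmaOne (q : ℝ) (X : ℝ≥0 → Ω → ℝ) (ε : ℝ) : MeasurableSpace Ω :=
  MeasurableSpace.comap (jumpInd q X ε 1) inferInstance

/-- The σ-algebra generated by all `J_k(ε)` with `k ≥ m`. -/
abbrev sigmaFrom (q : ℝ) (X : ℝ≥0 → Ω → ℝ) (ε : ℝ) (m : ℕ) : MeasurableSpace Ω :=
  ⨆ k ∈ Set.Ici m, MeasurableSpace.comap (jumpInd q X ε k) inferInstance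

end QOU

end

/-! The ratio `p_{0,δ}(x, y) / p(y)` is an infinite product whose factors differ from `1` by
`O(e^{-δ} |q|^k)`, hence it is within `O(e^{-δ})` of `1` for `δ ≥ 1`, uniformly on the domain. By
the Markov property this gives the mixing estimate whenever there is a gap between past and future,
that is for `m ≥ 2`.

For `m = 1` there is no gap, but `σ(J_1)` has at most two atoms, and it is enough to bound
`P(A ∩ B)` by a multiple of `P(A) P(B)` for each atom `A`. For the atom `J_1 = 0` this is possible
because its probability is at least that of staying positive for a unit of time, which depends on
`q` alone: by reversibility, the probability to stay in a set for the time `2t` is at least the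
square of that for the time `t`, and by right continuity it is positive for small `t`.

On the atom `J_1 = 1` it is clear, by monotonicity in `ε`, unless `ε` is small. Then the two end
zones are far apart, and the probability of a big jump in a given interval of length `h ≤ 1` is
comparable to `h` times the product of the masses of the zones: it is the limit of the probability
of a jump along a dyadic partition, which is estimated by Bonferroni's inequalities. Two big jumps
in the adjacent half intervals have a probability of the order of the square of that product, since
the process has to come back in between, and only the second half of `(0, 1]` touches `(1, 2]`. -/

noncomputable section

namespace QOU

open scoped ENNReal

/-! ### Infinite products with geometrically small factors -/

section Products

lemma abs_div_sub_one_le {a b m : ℝ} (hm : 0 < m) (hb : m ≤ b) : |a / b - 1| ≤ |a - b| / m := by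
  have hb0 := hm.trans_le hb
  rw [div_sub_one hb0.ne', abs_div, abs_of_pos hb0]
  exact div_le_div_of_nonneg_left (abs_nonneg _) hm hb

lemma exp_sub_one_le_mul_exp (z : ℝ) : Real.exp z - 1 ≤ z * Real.exp z := by
  have h := mul_le_mul_of_nonneg_left (Real.add_one_le_exp (-z)) (Real.exp_pos z).le
  rw [← Real.exp_add, add_neg_cancel, Real.exp_zero] at h
  linarith

variable {f : ℕ → ℝ} {M θ m : ℝ}

lemma multipliable_of_le_geometric (hθ0 : 0 ≤ θ) (hθ1 : θ < 1)
    (hf : ∀ k, |f k - 1| ≤ M * θ ^ k) : Multipliable f := by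
  have summable : Summable fun k => ‖f k - 1‖ := Summable.of_nonneg_of_le
    (fun _ => norm_nonneg _) hf ((summable_geometric_of_lt_one hθ0 hθ1).mul_left M)
  simpa using multipliable_one_add_of_summable summable

lemma abs_tprod_sub_one_le (hθ0 : 0 ≤ θ) (hθ1 : θ < 1) (hf : ∀ k, |f k - 1| ≤ M * θ ^ k) :
    |∏' k, f k - 1| ≤ Real.exp (M / (1 - θ)) - 1 := by
  have hmul := multipliable_of_le_geometric hθ0 hθ1 hf
  refine le_of_tendsto' (hmul.hasProd.tendsto_prod_nat.sub_const 1).abs fun n => ?_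
  have hprod := Finset.norm_prod_one_add_sub_one_le (Finset.range n) (fun k => f k - 1)
  simp only [add_sub_cancel, Real.norm_eq_abs] at hprod
  refine hprod.trans ?_
  gcongr
  calc ∑ k ∈ Finset.range n, |f k - 1| ≤ ∑ k ∈ Finset.range n, M * θ ^ k :=
        Finset.sum_le_sum fun k _ => hf k
    _ ≤ ∑' k, M * θ ^ k :=
        ((summable_geometric_of_lt_one hθ0 hθ1).mul_left M).sum_le_tsum _
          fun k _ => (abs_nonneg _).trans (hf k)
    _ = M / (1 - θ) := by rw [tsum_mul_left, tsum_geometric_of_lt_one hθ0 hθ1, div_eq_mul_inv]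

lemma tprod_le_exp (hθ0 : 0 ≤ θ) (hθ1 : θ < 1) (hf : ∀ k, |f k - 1| ≤ M * θ ^ k) :
    ∏' k, f k ≤ Real.exp (M / (1 - θ)) := by
  linarith [(abs_le.1 (abs_tprod_sub_one_le hθ0 hθ1 hf)).2]

lemma exp_le_tprod (hθ0 : 0 ≤ θ) (hθ1 : θ < 1) (hf : ∀ k, |f k - 1| ≤ M * θ ^ k)
    (hm : 0 < m) (hfm : ∀ k, m ≤ f k) : Real.exp (-(M / m / (1 - θ))) ≤ ∏' k, f k := by
  have hpos : ∀ k, 0 < f k := fun k => hm.trans_le (hfm k)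
  have hinv : ∀ k, |(f k)⁻¹ - 1| ≤ M / m * θ ^ k := fun k => by
    rw [← one_div, div_mul_eq_mul_div]
    refine (abs_div_sub_one_le hm (hfm k)).trans ?_
    rw [abs_sub_comm]
    exact div_le_div_of_nonneg_right (hf k) hm.le
  have hmul := multipliable_of_le_geometric hθ0 hθ1 hf
  have tprod_nonneg : 0 ≤ ∏' k, f k := ge_of_tendsto' hmul.hasProd.tendsto_prod_nat
    fun n => Finset.prod_nonneg fun k _ => (hpos k).le
  have tprod_mul_inv : (∏' k, f k) * ∏' k, (f k)⁻¹ = 1 := by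
    rw [← hmul.tprod_mul (multipliable_of_le_geometric hθ0 hθ1 hinv)]
    simp only [fun k => mul_inv_cancel₀ (hpos k).ne', tprod_one]
  rw [Real.exp_neg, inv_le_iff_one_le_mul₀ (Real.exp_pos _)]
  exact tprod_mul_inv.ge.trans
    (mul_le_mul_of_nonneg_left (tprod_le_exp hθ0 hθ1 hinv) tprod_nonneg)

end Products

/-! ### The factors of the transition density -/

/-- The interval `[-a_q, a_q]` on which the marginal density lives, with `a_q = endpt q`. -/
abbrev domain (q : ℝ) : Set ℝ := Set.Icc (-endpt q) (endpt q)

section Domain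

variable {q : ℝ}

lemma abs_lt_one_of_mem (hq : q ∈ Set.Ioo (-1 : ℝ) 1) : |q| < 1 := abs_lt.2 hq

lemma one_sub_pos_of_mem (hq : q ∈ Set.Ioo (-1 : ℝ) 1) : 0 < 1 - q := sub_pos.2 hq.2

lemma endpt_pos (hq : q ∈ Set.Ioo (-1 : ℝ) 1) : 0 < endpt q :=
  div_pos two_pos (Real.sqrt_pos.2 (one_sub_pos_of_mem hq))

lemma one_sub_mul_endpt_sq (hq : q ∈ Set.Ioo (-1 : ℝ) 1) : (1 - q) * endpt q ^ 2 = 4 := by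
  have := one_sub_pos_of_mem hq
  rw [endpt, div_pow, Real.sq_sqrt this.le]
  field_simp
  norm_num

lemma one_sub_mul_sq_le {x : ℝ} (hq : q ∈ Set.Ioo (-1 : ℝ) 1) (hx : x ∈ domain q) :
    (1 - q) * x ^ 2 ≤ 4 := by
  rw [← one_sub_mul_endpt_sq hq]
  exact mul_le_mul_of_nonneg_left (sq_le_sq' hx.1 hx.2) (one_sub_pos_of_mem hq).le

end Domain

/-- The factor `phi q k δ x y` as a polynomial in `ρ = e ^ (-δ) q ^ k`, with `c = 1 - q`. -/
def phiPoly (c ρ x y : ℝ) : ℝ :=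
  (1 - ρ ^ 2) ^ 2 - ρ * (1 + ρ ^ 2) * (c * x * y) + ρ ^ 2 * (c * (x ^ 2 + y ^ 2))

section PhiPoly

variable {c ρ x y : ℝ}

lemma phiPoly_neg_neg : phiPoly c (-ρ) x (-y) = phiPoly c ρ x y := by
  rw [phiPoly, phiPoly]; ring

lemma abs_mul_mul_le_four (hc : 0 ≤ c) (hx : c * x ^ 2 ≤ 4) (hy : c * y ^ 2 ≤ 4) :
    |c * x * y| ≤ 4 := by
  rw [abs_le]
  constructor <;> nlinarith [mul_nonneg hc (sq_nonneg (x - y)), mul_nonneg hc (sq_nonneg (x + y))]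

lemma add_le_phiPoly (hc : 0 ≤ c) (hx : c * x ^ 2 ≤ 4) (hy : c * y ^ 2 ≤ 4) (hρ : 0 ≤ ρ) :
    (1 - ρ) ^ 4 + ρ ^ 2 * (c * (x - y) ^ 2) ≤ phiPoly c ρ x y := by
  have hxy := (abs_le.1 (abs_mul_mul_le_four hc hx hy)).2
  have excess : phiPoly c ρ x y - ((1 - ρ) ^ 4 + ρ ^ 2 * (c * (x - y) ^ 2)) =
      ρ * (1 - ρ) ^ 2 * (4 - c * x * y) := by rw [phiPoly]; ring
  have : 0 ≤ ρ * (1 - ρ) ^ 2 * (4 - c * x * y) := by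
    have : 0 ≤ 4 - c * x * y := by linarith
    positivity
  linarith

lemma pow_le_phiPoly (hc : 0 ≤ c) (hx : c * x ^ 2 ≤ 4) (hy : c * y ^ 2 ≤ 4) :
    (1 - |ρ|) ^ 4 ≤ phiPoly c ρ x y := by
  wlog hρ : 0 ≤ ρ generalizing ρ y
  · rw [← phiPoly_neg_neg, ← abs_neg]
    exact this (by simpa using hy) (by linarith)
  rw [abs_of_nonneg hρ]
  exact (le_add_of_nonneg_right (by positivity)).trans (add_le_phiPoly hc hx hy hρ)

lemma abs_phiPoly_sub_one_le (hc : 0 ≤ c) (hx : c * x ^ 2 ≤ 4) (hy : c * y ^ 2 ≤ 4)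
    (hρ : |ρ| ≤ 1) : |phiPoly c ρ x y - 1| ≤ 18 * |ρ| := by
  have hxy := abs_mul_mul_le_four hc hx hy
  have hsum : |c * (x ^ 2 + y ^ 2)| ≤ 8 := by rw [abs_of_nonneg (by positivity)]; linarith
  have hρ2 : ρ ^ 2 ≤ 1 := by rw [← sq_abs]; exact pow_le_one₀ (abs_nonneg _) hρ
  have factor : phiPoly c ρ x y - 1 =
      (ρ * (ρ ^ 2 - 2) - (1 + ρ ^ 2) * (c * x * y) + ρ * (c * (x ^ 2 + y ^ 2))) * ρ := by
    rw [phiPoly]; ring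
  rw [factor, abs_mul]
  have term₁ : |ρ * (ρ ^ 2 - 2)| ≤ 1 * 2 := by
    rw [abs_mul]
    exact mul_le_mul hρ (abs_le.2 ⟨by linarith [sq_nonneg ρ], by linarith⟩) (abs_nonneg _)
      one_pos.le
  have term₂ : |(1 + ρ ^ 2) * (c * x * y)| ≤ 2 * 4 := by
    rw [abs_mul, abs_of_nonneg (by positivity : 0 ≤ 1 + ρ ^ 2)]
    exact mul_le_mul (by linarith) hxy (abs_nonneg _) two_pos.le
  have term₃ : |ρ * (c * (x ^ 2 + y ^ 2))| ≤ 1 * 8 := by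
    rw [abs_mul]
    exact mul_le_mul hρ hsum (abs_nonneg _) one_pos.le
  refine mul_le_mul_of_nonneg_right ?_ (abs_nonneg _)
  have := abs_add_le (ρ * (ρ ^ 2 - 2) - (1 + ρ ^ 2) * (c * x * y)) (ρ * (c * (x ^ 2 + y ^ 2)))
  have := abs_sub (ρ * (ρ ^ 2 - 2)) ((1 + ρ ^ 2) * (c * x * y))
  linarith

end PhiPoly

section Phi

variable {q δ x y : ℝ}

lemma phi_eq_phiPoly (k : ℕ) (δ x y : ℝ) :
    phi q k δ x y = phiPoly (1 - q) (Real.exp (-δ) * q ^ k) x y := by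
  have : Real.exp (-2 * δ) = Real.exp (-δ) ^ 2 := by
    rw [← Real.exp_nat_mul]; congr 1; push_cast; ring
  rw [phi, phiPoly, this]
  ring

lemma phi_symm (k : ℕ) (δ x y : ℝ) : phi q k δ x y = phi q k δ y x := by
  rw [phi, phi]; ring

lemma abs_exp_mul_pow (q δ : ℝ) (k : ℕ) :
    |Real.exp δ * q ^ k| = Real.exp δ * |q| ^ k := by
  rw [abs_mul, abs_pow, abs_of_pos (Real.exp_pos _)]

lemma exp_neg_mul_pow_le (k : ℕ) (hδ : 0 ≤ δ) : Real.exp (-δ) * |q| ^ k ≤ |q| ^ k :=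
  mul_le_of_le_one_left (by positivity) (Real.exp_le_one_iff.2 (neg_nonpos.2 hδ))

lemma abs_phi_sub_one_le (hq : q ∈ Set.Ioo (-1 : ℝ) 1) (k : ℕ) (hδ : 0 ≤ δ) (hx : x ∈ domain q)
    (hy : y ∈ domain q) : |phi q k δ x y - 1| ≤ 18 * (Real.exp (-δ) * |q| ^ k) := by
  rw [phi_eq_phiPoly, ← abs_exp_mul_pow]
  refine abs_phiPoly_sub_one_le (one_sub_pos_of_mem hq).le (one_sub_mul_sq_le hq hx)
    (one_sub_mul_sq_le hq hy) ?_
  rw [abs_exp_mul_pow]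
  exact (exp_neg_mul_pow_le k hδ).trans (pow_le_one₀ (abs_nonneg _) (abs_lt_one_of_mem hq).le)

lemma pow_le_phi (hq : q ∈ Set.Ioo (-1 : ℝ) 1) (k : ℕ) (hx : x ∈ domain q) (hy : y ∈ domain q) :
    (1 - Real.exp (-δ) * |q| ^ k) ^ 4 ≤ phi q k δ x y := by
  rw [phi_eq_phiPoly, ← abs_exp_mul_pow]
  exact pow_le_phiPoly (one_sub_pos_of_mem hq).le (one_sub_mul_sq_le hq hx)
    (one_sub_mul_sq_le hq hy)

lemma pow_le_phi_succ (hq : q ∈ Set.Ioo (-1 : ℝ) 1) (k : ℕ) (hδ : 0 ≤ δ) (hx : x ∈ domain q)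
    (hy : y ∈ domain q) : (1 - |q|) ^ 4 ≤ phi q (k + 1) δ x y := by
  have hq1 := abs_lt_one_of_mem hq
  have : Real.exp (-δ) * |q| ^ (k + 1) ≤ |q| := (exp_neg_mul_pow_le _ hδ).trans
    (pow_le_of_le_one (abs_nonneg _) hq1.le k.succ_ne_zero)
  exact (pow_le_pow_left₀ (by linarith) (by linarith) 4).trans (pow_le_phi hq (k + 1) hx hy)

lemma phi_zero_le (hq : q ∈ Set.Ioo (-1 : ℝ) 1) (hδ : 0 ≤ δ) (hx : x ∈ domain q)
    (hy : y ∈ domain q) : phi q 0 δ x y ≤ 19 := by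
  have h := (abs_le.1 (abs_phi_sub_one_le hq 0 hδ hx hy)).2
  have : Real.exp (-δ) ≤ 1 := Real.exp_le_one_iff.2 (neg_nonpos.2 hδ)
  simp only [pow_zero, mul_one] at h
  linarith

lemma le_phi_zero_of_far (hq : q ∈ Set.Ioo (-1 : ℝ) 1) (hx : x ∈ domain q) (hy : y ∈ domain q)
    (hxy : endpt q ≤ |x - y|) : 1 / 16 ≤ phi q 0 δ x y := by
  have hc := one_sub_pos_of_mem hq
  set ρ := Real.exp (-δ)
  have hρ0 : 0 ≤ ρ := Real.exp_nonneg _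
  have hdist : 4 ≤ (1 - q) * (x - y) ^ 2 := by
    rw [← one_sub_mul_endpt_sq hq, ← sq_abs (x - y)]
    exact mul_le_mul_of_nonneg_left (pow_le_pow_left₀ (endpt_pos hq).le hxy 2) hc.le
  have hphi : (1 - ρ) ^ 4 + ρ ^ 2 * ((1 - q) * (x - y) ^ 2) ≤ phi q 0 δ x y := by
    rw [phi_eq_phiPoly, pow_zero, mul_one]
    exact add_le_phiPoly hc.le (one_sub_mul_sq_le hq hx) (one_sub_mul_sq_le hq hy) hρ0
  refine le_trans ?_ hphi
  rcases le_total ρ (1 / 2) with h | h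
  · have : (1 / 2 : ℝ) ^ 4 ≤ (1 - ρ) ^ 4 := pow_le_pow_left₀ (by norm_num) (by linarith) 4
    have : 0 ≤ ρ ^ 2 * ((1 - q) * (x - y) ^ 2) := by positivity
    norm_num at *
    linarith
  · have : 0 ≤ (1 - ρ) ^ 4 := by positivity
    nlinarith

end Phi

/-! ### The density ratio -/

/-- The `k`-th factor of the product expansion of the ratio `p_{0,δ}(x, y) / p(y)`. -/
def ratioFactor (q : ℝ) (k : ℕ) (δ x y : ℝ) : ℝ :=
  (1 - Real.exp (-2 * δ) * q ^ k) / phi q k δ x y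

/-- The ratio `p_{0,δ}(x, y) / p(y)` of the transition density to the marginal density. -/
def ratio (q δ x y : ℝ) : ℝ := ∏' k : ℕ, ratioFactor q k δ x y

/-- The product of the factors of `ratio` with `k ≥ 1`, which stays bounded as `δ → 0`. -/
def ratioTail (q δ x y : ℝ) : ℝ := ∏' k : ℕ, ratioFactor q (k + 1) δ x y

/-- A lower bound for all the factors `phi q k δ x y`, uniform in `k` and in `x, y ∈ domain q`. -/
def phiBound (q δ : ℝ) : ℝ := min ((1 - Real.exp (-δ)) ^ 4) ((1 - |q|) ^ 4)

section Ratio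

variable {q δ x y : ℝ}

lemma one_sub_exp_neg_pos (hδ : 0 < δ) : 0 < 1 - Real.exp (-δ) :=
  sub_pos.2 (Real.exp_lt_one_iff.2 (neg_lt_zero.2 hδ))

lemma phiBound_pos (hq : q ∈ Set.Ioo (-1 : ℝ) 1) (hδ : 0 < δ) : 0 < phiBound q δ :=
  lt_min (pow_pos (one_sub_exp_neg_pos hδ) 4) (pow_pos (sub_pos.2 (abs_lt_one_of_mem hq)) 4)

lemma phiBound_mono {δ₀ : ℝ} (h0 : 0 < δ₀) (hδ : δ₀ ≤ δ) : phiBound q δ₀ ≤ phiBound q δ :=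
  min_le_min_right _ (pow_le_pow_left₀ (one_sub_exp_neg_pos h0).le
    (sub_le_sub_left (Real.exp_le_exp.2 (neg_le_neg hδ)) 1) 4)

lemma phiBound_le_phi (hq : q ∈ Set.Ioo (-1 : ℝ) 1) (k : ℕ) (hδ : 0 ≤ δ) (hx : x ∈ domain q)
    (hy : y ∈ domain q) : phiBound q δ ≤ phi q k δ x y := by
  cases k with
  | zero => exact (min_le_left _ _).trans (by simpa using pow_le_phi (δ := δ) hq 0 hx hy)
  | succ k => exact (min_le_right _ _).trans (pow_le_phi_succ hq k hδ hx hy)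

lemma abs_exp_neg_two_mul_pow_le (q : ℝ) (k : ℕ) (hδ : 0 ≤ δ) :
    |Real.exp (-2 * δ) * q ^ k| ≤ Real.exp (-δ) * |q| ^ k := by
  rw [abs_exp_mul_pow]
  exact mul_le_mul_of_nonneg_right (Real.exp_le_exp.2 (by linarith)) (by positivity)

lemma abs_ratioFactor_sub_one_le {m : ℝ} (hq : q ∈ Set.Ioo (-1 : ℝ) 1) (k : ℕ) (hδ : 0 ≤ δ)
    (hx : x ∈ domain q) (hy : y ∈ domain q) (hm : 0 < m) (hφ : m ≤ phi q k δ x y) :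
    |ratioFactor q k δ x y - 1| ≤ 19 / m * Real.exp (-δ) * |q| ^ k := by
  refine (abs_div_sub_one_le hm hφ).trans ?_
  rw [mul_assoc, div_mul_eq_mul_div]
  refine div_le_div_of_nonneg_right ?_ hm.le
  have hnum := abs_exp_neg_two_mul_pow_le q k hδ
  have hden := abs_phi_sub_one_le hq k hδ hx hy
  calc |1 - Real.exp (-2 * δ) * q ^ k - phi q k δ x y|
      = |Real.exp (-2 * δ) * q ^ k + (phi q k δ x y - 1)| := by rw [← abs_neg]; congr 1; ring
    _ ≤ |Real.exp (-2 * δ) * q ^ k| + |phi q k δ x y - 1| := abs_add_le _ _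
    _ ≤ 19 * (Real.exp (-δ) * |q| ^ k) := by linarith

lemma multipliable_ratioFactor (hq : q ∈ Set.Ioo (-1 : ℝ) 1) (hδ : 0 < δ) (hx : x ∈ domain q)
    (hy : y ∈ domain q) : Multipliable fun k : ℕ => ratioFactor q k δ x y :=
  multipliable_of_le_geometric (abs_nonneg q) (abs_lt_one_of_mem hq) fun k =>
    abs_ratioFactor_sub_one_le hq k hδ.le hx hy (phiBound_pos hq hδ)
      (phiBound_le_phi hq k hδ.le hx hy)

lemma qPoch_mul_tprod_eq_ratio (hq : q ∈ Set.Ioo (-1 : ℝ) 1) (hδ : 0 < δ) (hx : x ∈ domain q)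
    (hy : y ∈ domain q) :
    qPoch (Real.exp (-2 * δ)) q * ∏' k : ℕ, 1 / phi q k δ x y = ratio q δ x y := by
  have hq1 := abs_lt_one_of_mem hq
  have numerators : Multipliable fun k : ℕ => 1 - Real.exp (-2 * δ) * q ^ k := by
    refine multipliable_of_le_geometric (M := 1) (abs_nonneg q) hq1 fun k => ?_
    rw [sub_sub_cancel_left, abs_neg, one_mul]
    exact (abs_exp_neg_two_mul_pow_le q k hδ.le).trans (exp_neg_mul_pow_le k hδ.le)
  have denominators : Multipliable fun k : ℕ => 1 / phi q k δ x y := by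
    have hm := phiBound_pos hq hδ
    refine multipliable_of_le_geometric (M := 18 / phiBound q δ) (abs_nonneg q) hq1 fun k => ?_
    refine (abs_div_sub_one_le hm (phiBound_le_phi hq k hδ.le hx hy)).trans ?_
    rw [div_mul_eq_mul_div, abs_sub_comm]
    gcongr
    refine (abs_phi_sub_one_le hq k hδ.le hx hy).trans ?_
    gcongr
    exact exp_neg_mul_pow_le k hδ.le
  rw [qPoch, ratio, ← numerators.tprod_mul denominators]
  simp only [mul_one_div, ratioFactor]

lemma ratio_symm (q δ x y : ℝ) : ratio q δ x y = ratio q δ y x := by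
  simp only [ratio, ratioFactor, phi_symm _ _ x y]

/-- The factors of `ratio q δ x y`, `δ ≥ 1`, differ from `1` by at most `mixRate q * e ^ (-δ)` in
total. -/
def mixRate (q : ℝ) : ℝ := 19 / phiBound q 1 / (1 - |q|)

/-- The constant in `|p_{0,δ}(x, y) / p(y) - 1| ≤ mixConst q * e ^ (-δ)`, for `δ ≥ 1`. -/
def mixConst (q : ℝ) : ℝ := mixRate q * Real.exp (mixRate q)

lemma mixRate_nonneg (hq : q ∈ Set.Ioo (-1 : ℝ) 1) : 0 ≤ mixRate q :=
  div_nonneg (div_nonneg (by norm_num) (phiBound_pos hq one_pos).le)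
    (sub_pos.2 (abs_lt_one_of_mem hq)).le

lemma mixConst_nonneg (hq : q ∈ Set.Ioo (-1 : ℝ) 1) : 0 ≤ mixConst q :=
  mul_nonneg (mixRate_nonneg hq) (Real.exp_pos _).le

lemma abs_ratio_sub_one_le (hq : q ∈ Set.Ioo (-1 : ℝ) 1) (hδ : 1 ≤ δ) (hx : x ∈ domain q)
    (hy : y ∈ domain q) : |ratio q δ x y - 1| ≤ mixConst q * Real.exp (-δ) := by
  have hδ0 : 0 ≤ δ := zero_le_one.trans hδ
  have hφ : ∀ k, phiBound q 1 ≤ phi q k δ x y := fun k =>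
    (phiBound_mono one_pos hδ).trans (phiBound_le_phi hq k hδ0 hx hy)
  set z := mixRate q * Real.exp (-δ) with hz
  have hz0 : 0 ≤ z := mul_nonneg (mixRate_nonneg hq) (Real.exp_pos _).le
  have hzle : z ≤ mixRate q :=
    mul_le_of_le_one_right (mixRate_nonneg hq) (Real.exp_le_one_iff.2 (neg_nonpos.2 hδ0))
  calc |ratio q δ x y - 1| ≤ Real.exp (19 / phiBound q 1 * Real.exp (-δ) / (1 - |q|)) - 1 :=
        abs_tprod_sub_one_le (abs_nonneg q) (abs_lt_one_of_mem hq) fun k =>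
          abs_ratioFactor_sub_one_le hq k hδ0 hx hy (phiBound_pos hq one_pos) (hφ k)
    _ = Real.exp z - 1 := by rw [hz, mixRate]; congr 2; ring
    _ ≤ z * Real.exp z := exp_sub_one_le_mul_exp z
    _ ≤ z * Real.exp (mixRate q) := by gcongr
    _ = mixConst q * Real.exp (-δ) := by rw [hz, mixConst]; ring

lemma abs_ratioFactor_succ_sub_one_le (hq : q ∈ Set.Ioo (-1 : ℝ) 1) (k : ℕ) (hδ : 0 ≤ δ)
    (hx : x ∈ domain q) (hy : y ∈ domain q) :
    |ratioFactor q (k + 1) δ x y - 1| ≤ 19 / (1 - |q|) ^ 4 * |q| ^ k := by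
  have hq1 : 0 < 1 - |q| := sub_pos.2 (abs_lt_one_of_mem hq)
  refine (abs_ratioFactor_sub_one_le hq (k + 1) hδ hx hy (pow_pos hq1 4)
    (pow_le_phi_succ hq k hδ hx hy)).trans ?_
  rw [mul_assoc]
  refine mul_le_mul_of_nonneg_left ((exp_neg_mul_pow_le _ hδ).trans ?_) (by positivity)
  exact pow_le_pow_of_le_one (abs_nonneg _) (abs_lt_one_of_mem hq).le k.le_succ

lemma le_ratioFactor_succ (hq : q ∈ Set.Ioo (-1 : ℝ) 1) (k : ℕ) (hδ : 0 ≤ δ)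
    (hx : x ∈ domain q) (hy : y ∈ domain q) :
    (1 - |q|) / 19 ≤ ratioFactor q (k + 1) δ x y := by
  have hq1 : 0 < 1 - |q| := sub_pos.2 (abs_lt_one_of_mem hq)
  have hpow : Real.exp (-δ) * |q| ^ (k + 1) ≤ |q| := (exp_neg_mul_pow_le _ hδ).trans
    (pow_le_of_le_one (abs_nonneg _) (abs_lt_one_of_mem hq).le k.succ_ne_zero)
  have hden : phi q (k + 1) δ x y ≤ 19 := by
    linarith [(abs_le.1 (abs_phi_sub_one_le hq (k + 1) hδ hx hy)).2]
  have hnum : 1 - |q| ≤ 1 - Real.exp (-2 * δ) * q ^ (k + 1) := by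
    linarith [(abs_le.1 (abs_exp_neg_two_mul_pow_le q (k + 1) hδ)).2]
  exact div_le_div₀ (hq1.le.trans hnum) hnum
    ((pow_pos hq1 4).trans_le (pow_le_phi_succ hq k hδ hx hy)) hden

lemma exists_pos_le_ratioTail (hq : q ∈ Set.Ioo (-1 : ℝ) 1) :
    ∃ c > 0, ∀ δ, 0 ≤ δ → ∀ x ∈ domain q, ∀ y ∈ domain q, c ≤ ratioTail q δ x y :=
  ⟨_, Real.exp_pos _, fun _ hδ _ hx _ hy =>
    exp_le_tprod (abs_nonneg q) (abs_lt_one_of_mem hq)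
      (fun k => abs_ratioFactor_succ_sub_one_le hq k hδ hx hy)
      (div_pos (sub_pos.2 (abs_lt_one_of_mem hq)) (by norm_num))
      fun k => le_ratioFactor_succ hq k hδ hx hy⟩

lemma ratioTail_nonneg (hq : q ∈ Set.Ioo (-1 : ℝ) 1) (hδ : 0 ≤ δ) (hx : x ∈ domain q)
    (hy : y ∈ domain q) : 0 ≤ ratioTail q δ x y := by
  obtain ⟨c, hc, hle⟩ := exists_pos_le_ratioTail hq
  exact hc.le.trans (hle δ hδ x hx y hy)

lemma exists_ratioTail_le (hq : q ∈ Set.Ioo (-1 : ℝ) 1) :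
    ∃ C > 0, ∀ δ, 0 ≤ δ → ∀ x ∈ domain q, ∀ y ∈ domain q, ratioTail q δ x y ≤ C :=
  ⟨_, Real.exp_pos _, fun _ hδ _ hx _ hy =>
    tprod_le_exp (abs_nonneg q) (abs_lt_one_of_mem hq)
      fun k => abs_ratioFactor_succ_sub_one_le hq k hδ hx hy⟩

lemma ratio_eq_mul_ratioTail (hq : q ∈ Set.Ioo (-1 : ℝ) 1) (hδ : 0 ≤ δ) (hx : x ∈ domain q)
    (hy : y ∈ domain q) :
    ratio q δ x y = (1 - Real.exp (-2 * δ)) / phi q 0 δ x y * ratioTail q δ x y := by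
  rw [ratio, tprod_eq_zero_mul', ratioTail, ratioFactor, pow_zero, mul_one]
  exact multipliable_of_le_geometric (abs_nonneg q) (abs_lt_one_of_mem hq)
    fun k => abs_ratioFactor_succ_sub_one_le hq k hδ hx hy

lemma one_sub_exp_neg_two_mul_nonneg (hδ : 0 ≤ δ) : 0 ≤ 1 - Real.exp (-2 * δ) :=
  sub_nonneg.2 (Real.exp_le_one_iff.2 (by linarith))

lemma one_sub_exp_neg_two_mul_le_min (δ : ℝ) : 1 - Real.exp (-2 * δ) ≤ 2 * min δ 1 := by
  rw [mul_min_of_nonneg _ _ two_pos.le, le_min_iff]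
  constructor <;> linarith [Real.add_one_le_exp (-2 * δ), Real.exp_pos (-2 * δ)]

lemma half_le_one_sub_exp_neg_two_mul (hδ0 : 0 ≤ δ) (hδ1 : δ ≤ 1) :
    δ / 2 ≤ 1 - Real.exp (-2 * δ) := by
  have hexp : Real.exp (-2 * δ) ≤ 1 / (1 + δ) := by
    refine (Real.exp_le_exp.2 (by linarith : -2 * δ ≤ -δ)).trans ?_
    rw [Real.exp_neg, inv_eq_one_div]
    exact one_div_le_one_div_of_le (by linarith) (by linarith [Real.add_one_le_exp δ])
  have : 1 / (1 + δ) ≤ 1 - δ / 2 := by rw [div_le_iff₀ (by linarith)]; nlinarith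
  linarith

lemma ratio_nonneg (hq : q ∈ Set.Ioo (-1 : ℝ) 1) (hδ : 0 ≤ δ) (hx : x ∈ domain q)
    (hy : y ∈ domain q) : 0 ≤ ratio q δ x y := by
  have hφ := pow_le_phi (δ := δ) hq 0 hx hy
  rw [ratio_eq_mul_ratioTail hq hδ hx hy]
  exact mul_nonneg (div_nonneg (one_sub_exp_neg_two_mul_nonneg hδ)
    ((Even.pow_nonneg (by decide) _).trans hφ)) (ratioTail_nonneg hq hδ hx hy)

lemma exists_pos_mul_le_ratio (hq : q ∈ Set.Ioo (-1 : ℝ) 1) :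
    ∃ c > 0, ∀ δ ∈ Set.Icc (0 : ℝ) 1, ∀ x ∈ domain q, ∀ y ∈ domain q,
      c * δ ≤ ratio q δ x y := by
  obtain ⟨c, hc, htail⟩ := exists_pos_le_ratioTail hq
  refine ⟨c / 38, by positivity, fun δ ⟨hδ0, hδ1⟩ x hx y hy => ?_⟩
  rcases hδ0.eq_or_lt with rfl | hpos
  · rw [mul_zero]
    exact ratio_nonneg hq le_rfl hx hy
  have hφ : 0 < phi q 0 δ x y := (phiBound_pos hq hpos).trans_le (phiBound_le_phi hq 0 hδ0 hx hy)
  have hnum := one_sub_exp_neg_two_mul_nonneg hδ0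
  rw [ratio_eq_mul_ratioTail hq hδ0 hx hy]
  calc c / 38 * δ = δ / 2 / 19 * c := by ring
    _ ≤ (1 - Real.exp (-2 * δ)) / phi q 0 δ x y * ratioTail q δ x y :=
        mul_le_mul (div_le_div₀ hnum (half_le_one_sub_exp_neg_two_mul hδ0 hδ1) hφ
          (phi_zero_le hq hδ0 hx hy)) (htail δ hδ0 x hx y hy) hc.le (div_nonneg hnum hφ.le)

lemma exists_ratio_le (hq : q ∈ Set.Ioo (-1 : ℝ) 1) {δ₀ : ℝ} (hδ₀ : 0 < δ₀) :
    ∃ C > 0, ∀ δ, δ₀ ≤ δ → ∀ x ∈ domain q, ∀ y ∈ domain q, ratio q δ x y ≤ C := by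
  refine ⟨_, Real.exp_pos (19 / phiBound q δ₀ / (1 - |q|)), fun δ hδ x hx y hy => ?_⟩
  have hδ0 := hδ₀.le.trans hδ
  have hm := phiBound_pos hq hδ₀
  refine tprod_le_exp (abs_nonneg q) (abs_lt_one_of_mem hq) fun k =>
    (abs_ratioFactor_sub_one_le hq k hδ0 hx hy hm ((phiBound_mono hδ₀ hδ).trans
      (phiBound_le_phi hq k hδ0 hx hy))).trans ?_
  rw [mul_assoc]
  exact mul_le_mul_of_nonneg_left (exp_neg_mul_pow_le k hδ0) (by positivity)

lemma exists_ratio_le_mul_min_of_far (hq : q ∈ Set.Ioo (-1 : ℝ) 1) :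
    ∃ C > 0, ∀ δ, 0 ≤ δ → ∀ x ∈ domain q, ∀ y ∈ domain q, endpt q ≤ |x - y| →
      ratio q δ x y ≤ C * min δ 1 := by
  obtain ⟨C, hC, htail⟩ := exists_ratioTail_le hq
  refine ⟨32 * C, by positivity, fun δ hδ x hx y hy hfar => ?_⟩
  have hmin : 0 ≤ 2 * min δ 1 := mul_nonneg two_pos.le (le_min hδ zero_le_one)
  rw [ratio_eq_mul_ratioTail hq hδ hx hy]
  calc (1 - Real.exp (-2 * δ)) / phi q 0 δ x y * ratioTail q δ x y
      ≤ 2 * min δ 1 / (1 / 16) * C :=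
        mul_le_mul (div_le_div₀ hmin (one_sub_exp_neg_two_mul_le_min δ) (by norm_num)
          (le_phi_zero_of_far hq hx hy hfar)) (htail δ hδ x hx y hy)
          (ratioTail_nonneg hq hδ hx hy) (div_nonneg hmin (by norm_num))
    _ = 32 * C * min δ 1 := by ring

end Ratio

/-! ### The marginal density -/

section Dens

variable {q x : ℝ}

lemma abs_dens_factor_sub_one_le (hq : q ∈ Set.Ioo (-1 : ℝ) 1) (x : ℝ) (k : ℕ) :
    |(1 + q ^ (k + 1)) ^ 2 - (1 - q) * x ^ 2 * q ^ (k + 1) - 1|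
      ≤ (3 + (1 - q) * x ^ 2) * |q| ^ k := by
  have hx2 : 0 ≤ (1 - q) * x ^ 2 := mul_nonneg (one_sub_pos_of_mem hq).le (sq_nonneg x)
  have hq1 := (abs_lt_one_of_mem hq).le
  have hQ : |q ^ (k + 1)| ≤ |q| ^ k := by
    rw [abs_pow]
    exact pow_le_pow_of_le_one (abs_nonneg _) hq1 k.le_succ
  have hQ1 := abs_le.1 (hQ.trans (pow_le_one₀ (abs_nonneg _) hq1))
  set Q := q ^ (k + 1)
  have factor : (1 + Q) ^ 2 - (1 - q) * x ^ 2 * Q - 1 = (2 + Q - (1 - q) * x ^ 2) * Q := by ring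
  rw [factor, abs_mul]
  refine mul_le_mul (abs_le.2 ⟨?_, ?_⟩) hQ (abs_nonneg _) (by positivity) <;> linarith

lemma sq_le_dens_factor (hq : q ∈ Set.Ioo (-1 : ℝ) 1) (hx : x ∈ domain q) (k : ℕ) :
    (1 - |q|) ^ 2 ≤ (1 + q ^ (k + 1)) ^ 2 - (1 - q) * x ^ 2 * q ^ (k + 1) := by
  have hx4 := one_sub_mul_sq_le hq hx
  have hx0 : 0 ≤ (1 - q) * x ^ 2 := mul_nonneg (one_sub_pos_of_mem hq).le (sq_nonneg x)
  have hQ : |q ^ (k + 1)| ≤ |q| := by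
    rw [abs_pow]
    exact pow_le_of_le_one (abs_nonneg _) (abs_lt_one_of_mem hq).le k.succ_ne_zero
  set Q := q ^ (k + 1)
  refine (pow_le_pow_left₀ (sub_pos.2 (abs_lt_one_of_mem hq)).le (sub_le_sub_left hQ 1) 2).trans ?_
  rcases abs_cases Q with ⟨habs, hQ0⟩ | ⟨habs, hQ0⟩ <;> rw [habs] <;> nlinarith

lemma measurable_dens (hq : q ∈ Set.Ioo (-1 : ℝ) 1) : Measurable (dens q) := by
  have measurable_tprod : Measurable fun x : ℝ =>
      ∏' k : ℕ, ((1 + q ^ (k + 1)) ^ 2 - (1 - q) * x ^ 2 * q ^ (k + 1)) :=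
    measurable_of_tendsto_metrizable (f := fun n x => ∏ k ∈ Finset.range n,
      ((1 + q ^ (k + 1)) ^ 2 - (1 - q) * x ^ 2 * q ^ (k + 1))) (fun n => by fun_prop)
      (tendsto_pi_nhds.2 fun x => (multipliable_of_le_geometric (abs_nonneg q)
        (abs_lt_one_of_mem hq) (abs_dens_factor_sub_one_le hq x)).hasProd.tendsto_prod_nat)
  exact (by fun_prop : Measurable fun x : ℝ => √(1 - q) * qPoch q q / (2 * Real.pi) *
    √(4 - (1 - q) * x ^ 2)).mul measurable_tprod

lemma qPoch_self_pos (hq : q ∈ Set.Ioo (-1 : ℝ) 1) : 0 < qPoch q q := by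
  have hq1 := abs_lt_one_of_mem hq
  refine (Real.exp_pos _).trans_le (exp_le_tprod (M := |q|) (abs_nonneg q) hq1 (fun k => ?_)
    (sub_pos.2 hq1) fun k => sub_le_sub_left ?_ 1)
  · rw [sub_sub_cancel_left, abs_neg, abs_mul, abs_pow]
  · refine (le_abs_self _).trans ?_
    rw [abs_mul, abs_pow]
    exact mul_le_of_le_one_right (abs_nonneg _) (pow_le_one₀ (abs_nonneg _) hq1.le)

lemma dens_pos (hq : q ∈ Set.Ioo (-1 : ℝ) 1) (hx : x ∈ Set.Ioo (-endpt q) (endpt q)) :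
    0 < dens q x := by
  have hq1 : 0 < 1 - |q| := sub_pos.2 (abs_lt_one_of_mem hq)
  have hx4 : (1 - q) * x ^ 2 < 4 := by
    rw [← one_sub_mul_endpt_sq hq]
    exact mul_lt_mul_of_pos_left (sq_lt_sq' hx.1 hx.2) (one_sub_pos_of_mem hq)
  have tprod_pos : 0 < ∏' k : ℕ, ((1 + q ^ (k + 1)) ^ 2 - (1 - q) * x ^ 2 * q ^ (k + 1)) :=
    (Real.exp_pos _).trans_le (exp_le_tprod (abs_nonneg q) (abs_lt_one_of_mem hq)
      (abs_dens_factor_sub_one_le hq x) (pow_pos hq1 2)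
      (sq_le_dens_factor hq (Set.Ioo_subset_Icc_self hx)))
  have := qPoch_self_pos hq
  have : 0 < √(1 - q) := Real.sqrt_pos.2 (one_sub_pos_of_mem hq)
  have : 0 < √(4 - (1 - q) * x ^ 2) := Real.sqrt_pos.2 (sub_pos.2 hx4)
  unfold dens
  positivity

lemma dens_eq_zero (hq : q ∈ Set.Ioo (-1 : ℝ) 1) (hx : x ∉ Set.Ioo (-endpt q) (endpt q)) :
    dens q x = 0 := by
  have hle : endpt q ≤ |x| := not_lt.1 fun h => hx (abs_lt.1 h)
  have : 4 ≤ (1 - q) * x ^ 2 := by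
    rw [← one_sub_mul_endpt_sq hq, ← sq_abs x]
    exact mul_le_mul_of_nonneg_left (pow_le_pow_left₀ (endpt_pos hq).le hle 2)
      (one_sub_pos_of_mem hq).le
  rw [dens, Real.sqrt_eq_zero_of_nonpos (sub_nonpos.2 this), mul_zero, zero_mul]

lemma dens_nonneg (hq : q ∈ Set.Ioo (-1 : ℝ) 1) (x : ℝ) : 0 ≤ dens q x := by
  by_cases hx : x ∈ Set.Ioo (-endpt q) (endpt q)
  · exact (dens_pos hq hx).le
  · exact (dens_eq_zero hq hx).ge

end Dens

/-! ### The density ratio extended to the whole line -/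

/-- The point of `domain q` nearest to `x`. -/
def clamp (q x : ℝ) : ℝ := max (-endpt q) (min x (endpt q))

/-- The ratio `p_{0,δ}(x, y) / p(y)`, extended to all real `x, y` by clamping both to the domain,
so that bounds on the domain become bounds everywhere. -/
def clampedRatio (q δ x y : ℝ) : ℝ := ratio q δ (clamp q x) (clamp q y)

section Clamp

variable {q δ x y : ℝ}

lemma clamp_mem (hq : q ∈ Set.Ioo (-1 : ℝ) 1) (x : ℝ) : clamp q x ∈ domain q :=
  ⟨le_max_left _ _, max_le (by linarith [endpt_pos hq]) (min_le_right _ _)⟩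

lemma clamp_of_mem (hx : x ∈ domain q) : clamp q x = x := by
  rw [clamp, min_eq_left hx.2, max_eq_right hx.1]

lemma endpt_le_abs_clamp_sub {b : ℝ} (hb : endpt q / 2 ≤ b) (hb' : b < endpt q)
    (hx : x < -b) (hy : b < y) : endpt q ≤ |clamp q x - clamp q y| := by
  have hcx : clamp q x ≤ -b := max_le (by linarith) ((min_le_left _ _).trans hx.le)
  have hcy : b ≤ clamp q y := le_max_of_le_right (le_min hy.le hb'.le)
  rw [abs_sub_comm]
  exact le_trans (by linarith) (le_abs_self _)

lemma clampedRatio_symm (q δ x y : ℝ) : clampedRatio q δ x y = clampedRatio q δ y x :=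
  ratio_symm _ _ _ _

lemma clampedRatio_nonneg (hq : q ∈ Set.Ioo (-1 : ℝ) 1) (hδ : 0 ≤ δ) :
    0 ≤ clampedRatio q δ x y :=
  ratio_nonneg hq hδ (clamp_mem hq x) (clamp_mem hq y)

lemma measurable_clampedRatio (hq : q ∈ Set.Ioo (-1 : ℝ) 1) (hδ : 0 < δ) :
    Measurable fun z : ℝ × ℝ => clampedRatio q δ z.1 z.2 := by
  refine measurable_of_tendsto_metrizable (f := fun n (z : ℝ × ℝ) => ∏ k ∈ Finset.range n,
    ratioFactor q k δ (clamp q z.1) (clamp q z.2)) (fun n => ?_) (tendsto_pi_nhds.2 fun z => ?_)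
  · refine Finset.measurable_fun_prod _ fun k _ => ?_
    unfold ratioFactor phi clamp
    fun_prop
  · exact (multipliable_ratioFactor hq hδ (clamp_mem hq _)
      (clamp_mem hq _)).hasProd.tendsto_prod_nat

lemma transDens_eq {s t : ℝ} (hq : q ∈ Set.Ioo (-1 : ℝ) 1) (hst : s < t) (hx : x ∈ domain q)
    (y : ℝ) : transDens q s t x y = clampedRatio q (t - s) x y * dens q y := by
  by_cases hy : y ∈ Set.Ioo (-endpt q) (endpt q)
  · have hy' := Set.Ioo_subset_Icc_self hy
    rw [transDens, qPoch_mul_tprod_eq_ratio hq (sub_pos.2 hst) hx hy', clampedRatio,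
      clamp_of_mem hx, clamp_of_mem hy']
  · rw [transDens, dens_eq_zero hq hy, mul_zero, mul_zero]

lemma abs_transDens_div_dens_sub_one_le {s t : ℝ} (hq : q ∈ Set.Ioo (-1 : ℝ) 1)
    (hst : 1 ≤ t - s) (hx : x ∈ domain q) (hy : y ∈ Set.Ioo (-endpt q) (endpt q)) :
    |transDens q s t x y / dens q y - 1| ≤ mixConst q * Real.exp (-(t - s)) := by
  rw [transDens_eq hq (by linarith) hx, mul_div_cancel_right₀ _ (dens_pos hq hy).ne']
  exact abs_ratio_sub_one_le hq hst (clamp_mem hq x) (clamp_mem hq y)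

end Clamp

/-! ### Reversible Markov processes -/

section Markov

variable {Ω E : Type*} [MeasurableSpace E]

/-- The σ-algebra generated by the process up to time `s`. -/
abbrev past (X : ℝ≥0 → Ω → E) (s : ℝ≥0) : MeasurableSpace Ω :=
  ⨆ u ∈ Set.Iic s, MeasurableSpace.comap (X u) inferInstance

/-- The σ-algebra generated by the process from time `s` on. -/
abbrev future (X : ℝ≥0 → Ω → E) (s : ℝ≥0) : MeasurableSpace Ω :=
  ⨆ u ∈ Set.Ici s, MeasurableSpace.comap (X u) inferInstance

variable {X : ℝ≥0 → Ω → E} {s t u : ℝ≥0}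

lemma past_mono (h : s ≤ t) : past X s ≤ past X t :=
  biSup_mono fun _ hu => le_trans hu h

lemma future_anti (h : s ≤ t) : future X t ≤ future X s :=
  biSup_mono fun _ hu => le_trans h hu

lemma measurable_past (h : u ≤ s) : Measurable[past X s] (X u) :=
  measurable_iff_comap_le.2 (le_biSup (fun u => MeasurableSpace.comap (X u) inferInstance) h)

lemma measurable_future (h : s ≤ u) : Measurable[future X s] (X u) :=
  measurable_iff_comap_le.2 (le_biSup (fun u => MeasurableSpace.comap (X u) inferInstance) h)

lemma ext_of_cylinders (X : ℝ≥0 → Ω → E) (s : ℝ≥0) {ν ν' : @Measure Ω (future X s)}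
    [@IsFiniteMeasure Ω (future X s) ν]
    (hcyl : ∀ (F : Finset ℝ≥0), (∀ u ∈ F, s ≤ u) → ∀ A : ℝ≥0 → Set E,
      (∀ u ∈ F, MeasurableSet (A u)) →
      ν (⋂ u ∈ F, X u ⁻¹' A u) = ν' (⋂ u ∈ F, X u ⁻¹' A u)) : ν = ν' := by
  refine @ext_of_generate_finite _ (future X s) _ _ _
    (generateFrom_piiUnionInter_measurableSet
      (fun u => MeasurableSpace.comap (X u) inferInstance) (Set.Ici s)).symm
    (isPiSystem_piiUnionInter _ (fun u => @MeasurableSpace.isPiSystem_measurableSet Ω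
      (MeasurableSpace.comap (X u) inferInstance)) _) ‹_› ?_ ?_
  · rintro Q ⟨F, hF, f, hf, rfl⟩
    choose! A hA hfA using hf
    rw [← Set.iInter₂_congr fun u hu => hfA u hu]
    exact hcyl F (fun u hu => hF hu) A hA
  · simpa using hcyl ∅

/-- `X` is a stationary Markov process with marginal law `π`, and `r δ` is the density of the law
of `(X s, X (s + δ))` with respect to `π × π`. Symmetry of `r δ` is reversibility in time. -/
structure IsReversibleMarkov [MeasurableSpace Ω] (X : ℝ≥0 → Ω → E) (μ : Measure Ω)
    (π : Measure E) (r : ℝ≥0 → E → E → ℝ≥0∞) : Prop where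
  measurable : ∀ t, Measurable (X t)
  map_eq : ∀ t, μ.map (X t) = π
  measurable_ratio : ∀ δ, 0 < δ → Measurable fun z : E × E => r δ z.1 z.2
  symm : ∀ δ x y, r δ x y = r δ y x
  markov : ∀ s t, s < t → ∀ A, MeasurableSet A → ∀ G, MeasurableSet[past X s] G →
    μ (G ∩ X t ⁻¹' A) = ∫⁻ ω in G, ∫⁻ y in A, r (t - s) (X s ω) y ∂π ∂μ

namespace IsReversibleMarkov

variable [MeasurableSpace Ω] {μ : Measure Ω} {π : Measure E} {r : ℝ≥0 → E → E → ℝ≥0∞}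

lemma past_le (h : IsReversibleMarkov X μ π r) (s : ℝ≥0) : past X s ≤ ‹MeasurableSpace Ω› :=
  iSup₂_le fun u _ => (h.measurable u).comap_le

lemma future_le (h : IsReversibleMarkov X μ π r) (s : ℝ≥0) : future X s ≤ ‹MeasurableSpace Ω› :=
  iSup₂_le fun u _ => (h.measurable u).comap_le

lemma measure_preimage (h : IsReversibleMarkov X μ π r) (t : ℝ≥0) {A : Set E}
    (hA : MeasurableSet A) : μ (X t ⁻¹' A) = π A := by
  rw [← h.map_eq t, Measure.map_apply (h.measurable t) hA]

lemma setLIntegral_comp (h : IsReversibleMarkov X μ π r) (t : ℝ≥0) {A : Set E}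
    (hA : MeasurableSet A) {g : E → ℝ≥0∞} (hg : Measurable g) :
    ∫⁻ ω in X t ⁻¹' A, g (X t ω) ∂μ = ∫⁻ y in A, g y ∂π := by
  rw [← h.map_eq t, setLIntegral_map hA hg (h.measurable t)]

lemma measurable_kernel [SFinite π] (h : IsReversibleMarkov X μ π r) {δ : ℝ≥0} (hδ : 0 < δ)
    (A : Set E) : Measurable fun x => ∫⁻ y in A, r δ x y ∂π :=
  (h.measurable_ratio δ hδ).lintegral_prod_right'

lemma lintegral_markov [SFinite π] (h : IsReversibleMarkov X μ π r) (hst : s < t) {A : Set E}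
    (hA : MeasurableSet A) {w : Ω → ℝ≥0∞} (hw : Measurable[past X s] w) :
    ∫⁻ ω in X t ⁻¹' A, w ω ∂μ =
      ∫⁻ ω, w ω * ∫⁻ y in A, r (t - s) (X s ω) y ∂π ∂μ := by
  have hk : Measurable fun ω => ∫⁻ y in A, r (t - s) (X s ω) y ∂π :=
    (h.measurable_kernel (tsub_pos_of_lt hst) A).comp (h.measurable s)
  have hle := h.past_le s
  have trim_eq : (μ.restrict (X t ⁻¹' A)).trim hle =
      (μ.withDensity fun ω => ∫⁻ y in A, r (t - s) (X s ω) y ∂π).trim hle := by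
    refine @Measure.ext _ (past X s) _ _ fun G hG => ?_
    rw [trim_measurableSet_eq hle hG, trim_measurableSet_eq hle hG,
      Measure.restrict_apply (hle _ hG), withDensity_apply _ (hle _ hG),
      h.markov s t hst A hA G hG]
  calc ∫⁻ ω in X t ⁻¹' A, w ω ∂μ = ∫⁻ ω, w ω ∂((μ.restrict (X t ⁻¹' A)).trim hle) :=
        (lintegral_trim hle hw).symm
    _ = ∫⁻ ω, w ω ∂(μ.withDensity fun ω => ∫⁻ y in A, r (t - s) (X s ω) y ∂π) := by
        rw [trim_eq, lintegral_trim hle hw]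
    _ = _ := by
        rw [lintegral_withDensity_eq_lintegral_mul _ hk (hw.mono hle le_rfl)]
        exact lintegral_congr fun ω => mul_comm _ _

lemma lintegral_mul_comp_congr (h : IsReversibleMarkov X μ π r) {w w' : Ω → ℝ≥0∞}
    (hw : Measurable w) (hw' : Measurable w')
    (hww' : ∀ A, MeasurableSet A → ∫⁻ ω in X s ⁻¹' A, w ω ∂μ = ∫⁻ ω in X s ⁻¹' A, w' ω ∂μ)
    {g : E → ℝ≥0∞} (hg : Measurable g) :
    ∫⁻ ω, w ω * g (X s ω) ∂μ = ∫⁻ ω, w' ω * g (X s ω) ∂μ := by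
  have images_eq : (μ.withDensity w).map (X s) = (μ.withDensity w').map (X s) := by
    ext A hA
    rw [Measure.map_apply (h.measurable s) hA, Measure.map_apply (h.measurable s) hA,
      withDensity_apply _ (h.measurable s hA), withDensity_apply _ (h.measurable s hA), hww' A hA]
  have lintegral_eq : ∀ v : Ω → ℝ≥0∞, Measurable v →
      ∫⁻ ω, v ω * g (X s ω) ∂μ = ∫⁻ x, g x ∂((μ.withDensity v).map (X s)) := fun v hv => by
    rw [lintegral_map hg (h.measurable s),
      lintegral_withDensity_eq_lintegral_mul₀ hv.aemeasurable (f := v)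
        (g := fun ω => g (X s ω)) (hg.comp (h.measurable s)).aemeasurable]
    rfl
  rw [lintegral_eq w hw, lintegral_eq w' hw', images_eq]

lemma setLIntegral_cylinder_congr [SFinite π] (h : IsReversibleMarkov X μ π r) (F : Finset ℝ≥0) :
    ∀ s, (∀ u ∈ F, s ≤ u) → ∀ A : ℝ≥0 → Set E, (∀ u ∈ F, MeasurableSet (A u)) →
    ∀ w w' : Ω → ℝ≥0∞, Measurable[past X s] w → Measurable[past X s] w' →
    (∀ A, MeasurableSet A → ∫⁻ ω in X s ⁻¹' A, w ω ∂μ = ∫⁻ ω in X s ⁻¹' A, w' ω ∂μ) →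
    ∫⁻ ω in ⋂ u ∈ F, X u ⁻¹' A u, w ω ∂μ = ∫⁻ ω in ⋂ u ∈ F, X u ⁻¹' A u, w' ω ∂μ := by
  induction F using Finset.induction_on_min with
  | empty =>
    intro s _ A _ w w' _ _ hww'
    simpa using hww' Set.univ MeasurableSet.univ
  | insert a F ha ih =>
    intro s hs A hA w w' hw hw' hww'
    have hAa : MeasurableSet (A a) := hA a (Finset.mem_insert_self a F)
    have hsa : s ≤ a := hs a (Finset.mem_insert_self a F)
    have indicator_eq : ∀ (v : Ω → ℝ≥0∞) (Q : Set Ω),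
        ∫⁻ ω in Q, (X a ⁻¹' A a).indicator v ω ∂μ = ∫⁻ ω in X a ⁻¹' A a ∩ Q, v ω ∂μ :=
      fun v Q => by rw [setLIntegral_indicator (h.measurable a hAa)]
    have measurable_indicator : ∀ v : Ω → ℝ≥0∞, Measurable[past X s] v →
        Measurable[past X a] ((X a ⁻¹' A a).indicator v) := fun v hv =>
      (hv.mono (past_mono hsa) le_rfl).indicator (measurable_past le_rfl hAa)
    rw [Finset.set_biInter_insert, ← indicator_eq w, ← indicator_eq w']
    refine ih a (fun u hu => (ha u hu).le) A (fun u hu => hA u (Finset.mem_insert_of_mem hu)) _ _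
      (measurable_indicator w hw) (measurable_indicator w' hw') fun B hB => ?_
    rw [indicator_eq, indicator_eq, ← Set.preimage_inter]
    rcases hsa.eq_or_lt with rfl | hlt
    · exact hww' _ (hAa.inter hB)
    · rw [h.lintegral_markov hlt (hAa.inter hB) hw, h.lintegral_markov hlt (hAa.inter hB) hw']
      exact h.lintegral_mul_comp_congr (hw.mono (h.past_le s) le_rfl)
        (hw'.mono (h.past_le s) le_rfl) hww' (h.measurable_kernel (tsub_pos_of_lt hlt) _)

lemma setLIntegral_future_congr [SFinite π] (h : IsReversibleMarkov X μ π r) {w w' : Ω → ℝ≥0∞}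
    (hw : Measurable[past X s] w) (hw' : Measurable[past X s] w') (hfin : ∫⁻ ω, w ω ∂μ ≠ ∞)
    (hww' : ∀ A, MeasurableSet A → ∫⁻ ω in X s ⁻¹' A, w ω ∂μ = ∫⁻ ω in X s ⁻¹' A, w' ω ∂μ)
    {H : Set Ω} (hH : MeasurableSet[future X s] H) :
    ∫⁻ ω in H, w ω ∂μ = ∫⁻ ω in H, w' ω ∂μ := by
  have hle := h.future_le s
  have : IsFiniteMeasure (μ.withDensity w) := isFiniteMeasure_withDensity hfin
  have trim_apply : ∀ (v : Ω → ℝ≥0∞) (Q : Set Ω), MeasurableSet[future X s] Q →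
      (μ.withDensity v).trim hle Q = ∫⁻ ω in Q, v ω ∂μ := fun v Q hQ => by
    rw [trim_measurableSet_eq hle hQ, withDensity_apply _ (hle _ hQ)]
  have trim_eq : (μ.withDensity w).trim hle = (μ.withDensity w').trim hle := by
    have : IsFiniteMeasure ((μ.withDensity w).trim hle) := isFiniteMeasure_trim hle
    refine ext_of_cylinders X s fun F hF A hA => ?_
    have hmeas : MeasurableSet[future X s] (⋂ u ∈ F, X u ⁻¹' A u) :=
      Finset.measurableSet_biInter _ fun u hu => measurable_future (hF u hu) (hA u hu)
    rw [trim_apply _ _ hmeas, trim_apply _ _ hmeas]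
    exact h.setLIntegral_cylinder_congr F s hF A hA w w' hw hw' hww'
  rw [← trim_apply w H hH, ← trim_apply w' H hH, trim_eq]

lemma measure_inter_eq_of_density [IsFiniteMeasure μ] [SFinite π]
    (h : IsReversibleMarkov X μ π r) {G H : Set Ω} (hG : MeasurableSet[past X s] G)
    (hH : MeasurableSet[future X s] H) {g : E → ℝ≥0∞} (hg : Measurable g)
    (hGg : ∀ A, MeasurableSet A → μ (G ∩ X s ⁻¹' A) = ∫⁻ y in A, g y ∂π) :
    μ (G ∩ H) = ∫⁻ ω in H, g (X s ω) ∂μ := by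
  have hG' := h.past_le s _ hG
  have indicator_eq : ∀ Q : Set Ω, ∫⁻ ω in Q, G.indicator 1 ω ∂μ = μ (G ∩ Q) := fun Q => by
    rw [lintegral_indicator_one hG', Measure.restrict_apply hG']
  rw [← indicator_eq]
  refine h.setLIntegral_future_congr (w := G.indicator 1) (w' := fun ω => g (X s ω))
    (Measurable.indicator (@measurable_const _ _ _ (past X s) 1) hG)
    (hg.comp (measurable_past le_rfl)) ?_ (fun A hA => ?_) hH
  · rw [lintegral_indicator_one hG']
    exact measure_ne_top _ _
  · rw [indicator_eq, hGg A hA, h.setLIntegral_comp s hA hg]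

lemma measurable_ratio_comp (h : IsReversibleMarkov X μ π r) (hst : s < t) :
    Measurable fun z : Ω × E => r (t - s) (X s z.1) z.2 :=
  (h.measurable_ratio _ (tsub_pos_of_lt hst)).comp
    (((h.measurable s).comp measurable_fst).prodMk measurable_snd)

lemma measure_inter_preimage [SFinite μ] [SFinite π] (h : IsReversibleMarkov X μ π r)
    (hst : s < t) {G : Set Ω} (hG : MeasurableSet[past X s] G) {A : Set E}
    (hA : MeasurableSet A) :
    μ (G ∩ X t ⁻¹' A) = ∫⁻ y in A, ∫⁻ ω in G, r (t - s) (X s ω) y ∂μ ∂π := by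
  rw [h.markov s t hst A hA G hG, lintegral_lintegral_swap]
  exact (h.measurable_ratio_comp hst).aemeasurable

lemma measure_inter_eq [IsFiniteMeasure μ] [SFinite π] (h : IsReversibleMarkov X μ π r)
    (hst : s < t) {G H : Set Ω} (hG : MeasurableSet[past X s] G)
    (hH : MeasurableSet[future X t] H) :
    μ (G ∩ H) = ∫⁻ ω in H, ∫⁻ ω' in G, r (t - s) (X s ω') (X t ω) ∂μ ∂μ :=
  h.measure_inter_eq_of_density (past_mono hst.le _ hG) hH
    (h.measurable_ratio_comp hst).lintegral_prod_left'
    fun _ hA => h.measure_inter_preimage hst hG hA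

lemma measure_inter_le [IsFiniteMeasure μ] [SFinite π] (h : IsReversibleMarkov X μ π r)
    (hst : s < t) {G H : Set Ω} (hG : MeasurableSet[past X s] G)
    (hH : MeasurableSet[future X t] H) {C : ℝ≥0∞}
    (hC : ∀ ω' ∈ G, ∀ ω ∈ H, r (t - s) (X s ω') (X t ω) ≤ C) :
    μ (G ∩ H) ≤ C * μ G * μ H :=
  calc μ (G ∩ H) ≤ ∫⁻ _ in H, ∫⁻ _ in G, C ∂μ ∂μ := by
        rw [h.measure_inter_eq hst hG hH]
        exact setLIntegral_mono' (h.future_le t _ hH) fun ω hω =>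
          setLIntegral_mono' (h.past_le s _ hG) fun ω' hω' => hC ω' hω' ω hω
    _ = C * μ G * μ H := by rw [setLIntegral_const, setLIntegral_const]

lemma le_measure_inter [IsFiniteMeasure μ] [SFinite π] (h : IsReversibleMarkov X μ π r)
    (hst : s < t) {G H : Set Ω} (hG : MeasurableSet[past X s] G)
    (hH : MeasurableSet[future X t] H) {c : ℝ≥0∞}
    (hc : ∀ ω' ∈ G, ∀ ω ∈ H, c ≤ r (t - s) (X s ω') (X t ω)) :
    c * μ G * μ H ≤ μ (G ∩ H) :=
  calc c * μ G * μ H = ∫⁻ _ in H, ∫⁻ _ in G, c ∂μ ∂μ := by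
        rw [setLIntegral_const, setLIntegral_const]
    _ ≤ μ (G ∩ H) := by
        rw [h.measure_inter_eq hst hG hH]
        exact setLIntegral_mono' (h.future_le t _ hH) fun ω hω =>
          setLIntegral_mono' (h.past_le s _ hG) fun ω' hω' => hc ω' hω' ω hω

end IsReversibleMarkov

end Markov

/-! ### The process as a reversible Markov process -/

/-- The marginal law of the process. -/
def law (q : ℝ) : Measure ℝ := volume.withDensity fun x => ENNReal.ofReal (dens q x)

/-- `clampedRatio` with values in `[0, ∞]`: the density ratio of the process as a reversible
Markov process. -/
def eratio (q : ℝ) (δ : ℝ≥0) (x y : ℝ) : ℝ≥0∞ := ENNReal.ofReal (clampedRatio q δ x y)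

section QOUMarkov

variable {q : ℝ}

lemma law_Ioo_compl (hq : q ∈ Set.Ioo (-1 : ℝ) 1) :
    law q (Set.Ioo (-endpt q) (endpt q))ᶜ = 0 := by
  rw [law, withDensity_apply _ measurableSet_Ioo.compl]
  refine (setLIntegral_congr_fun measurableSet_Ioo.compl fun x hx => ?_).trans lintegral_zero
  rw [dens_eq_zero hq hx, ENNReal.ofReal_zero]

lemma measurable_eratio (hq : q ∈ Set.Ioo (-1 : ℝ) 1) {δ : ℝ≥0} (hδ : 0 < δ) :
    Measurable fun z : ℝ × ℝ => eratio q δ z.1 z.2 :=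
  (measurable_clampedRatio hq hδ).ennreal_ofReal

lemma exists_setLIntegral_eratio_le [IsProbabilityMeasure (law q)]
    (hq : q ∈ Set.Ioo (-1 : ℝ) 1) {δ : ℝ≥0} (hδ : 0 < δ) (A : Set ℝ) :
    ∃ C : ℝ, ∀ x, ∫⁻ y in A, eratio q δ x y ∂(law q) ≤ ENNReal.ofReal C := by
  obtain ⟨C, -, hC⟩ := exists_ratio_le hq (NNReal.coe_pos.2 hδ)
  refine ⟨C, fun x => ?_⟩
  calc ∫⁻ y in A, eratio q δ x y ∂(law q) ≤ ∫⁻ _ in A, ENNReal.ofReal C ∂(law q) :=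
        lintegral_mono fun y => ENNReal.ofReal_le_ofReal
          (hC _ le_rfl _ (clamp_mem hq _) _ (clamp_mem hq _))
    _ ≤ ENNReal.ofReal C := by
        rw [setLIntegral_const]
        exact mul_le_of_le_one_right' prob_le_one

lemma setIntegral_transDens (hq : q ∈ Set.Ioo (-1 : ℝ) 1) {s t : ℝ≥0} (hst : s < t)
    {A : Set ℝ} (hA : MeasurableSet A) {x : ℝ} (hx : x ∈ domain q) :
    ∫ y in A, transDens q s t x y = (∫⁻ y in A, eratio q (t - s) x y ∂(law q)).toReal := by
  have hδ : 0 < t - s := tsub_pos_of_lt hst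
  have measurable_right : Measurable fun y => clampedRatio q (t - s : ℝ≥0) x y :=
    (measurable_clampedRatio hq hδ).comp (measurable_const.prodMk measurable_id)
  have nonneg : ∀ y, 0 ≤ clampedRatio q (t - s : ℝ≥0) x y := fun y =>
    clampedRatio_nonneg hq (t - s).coe_nonneg
  simp only [transDens_eq hq (NNReal.coe_lt_coe.2 hst) hx, ← NNReal.coe_sub hst.le, eratio]
  rw [integral_eq_lintegral_of_nonneg_ae
      (ae_of_all _ fun y => mul_nonneg (nonneg y) (dens_nonneg hq y))
      (measurable_right.mul (measurable_dens hq)).aestronglyMeasurable, law,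
    setLIntegral_withDensity_eq_setLIntegral_mul volume (measurable_dens hq).ennreal_ofReal
      measurable_right.ennreal_ofReal hA]
  congr 1
  refine lintegral_congr fun y => ?_
  rw [Pi.mul_apply, mul_comm, ENNReal.ofReal_mul (dens_nonneg hq y), mul_comm]

namespace IsQOUProcess

variable {Ω : Type*} [MeasurableSpace Ω] {X : ℝ≥0 → Ω → ℝ} {μ : Measure Ω}

lemma isProbabilityMeasure_law [IsProbabilityMeasure μ] (h : IsQOUProcess q X μ) :
    IsProbabilityMeasure (law q) := by
  rw [law, ← h.marginal 0]
  exact Measure.isProbabilityMeasure_map (h.measurable 0).aemeasurable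

lemma ae_mem_domain (hq : q ∈ Set.Ioo (-1 : ℝ) 1) (h : IsQOUProcess q X μ) (t : ℝ≥0) :
    ∀ᵐ ω ∂μ, X t ω ∈ domain q := by
  have ae_mem : ∀ᵐ x ∂μ.map (X t), x ∈ domain q := by
    rw [h.marginal t]
    exact measure_mono_null (Set.compl_subset_compl.2 Set.Ioo_subset_Icc_self) (law_Ioo_compl hq)
  exact ae_of_ae_map (h.measurable t).aemeasurable ae_mem

lemma setIntegral_kernel [IsFiniteMeasure μ] (hq : q ∈ Set.Ioo (-1 : ℝ) 1)
    (h : IsQOUProcess q X μ) {s t : ℝ≥0} (hst : s < t) {A : Set ℝ} (hA : MeasurableSet A)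
    {G : Set Ω} (hG : MeasurableSet[past X s] G) :
    ∫ ω in G, (∫⁻ y in A, eratio q (t - s) (X s ω) y ∂(law q)).toReal ∂μ =
      μ.real (G ∩ X t ⁻¹' A) := by
  have hAt := h.measurable t hA
  calc ∫ ω in G, (∫⁻ y in A, eratio q (t - s) (X s ω) y ∂(law q)).toReal ∂μ
      = ∫ ω in G, (μ[(X t ⁻¹' A).indicator (fun _ => (1 : ℝ)) | past X s]) ω ∂μ := by
        refine integral_congr_ae (ae_restrict_of_ae ?_)
        filter_upwards [h.markov s t hst A hA, h.ae_mem_domain hq s] with ω hω hmem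
        rw [hω, setIntegral_transDens hq hst hA hmem]
    _ = ∫ ω in G, (X t ⁻¹' A).indicator (fun _ => (1 : ℝ)) ω ∂μ :=
        setIntegral_condExp (iSup₂_le fun u _ => (h.measurable u).comap_le)
          ((integrable_const _).indicator hAt) hG
    _ = μ.real (G ∩ X t ⁻¹' A) := by
        rw [integral_indicator hAt, setIntegral_const, smul_eq_mul, mul_one,
          measureReal_restrict_apply hAt, Set.inter_comm]

lemma isReversibleMarkov [IsProbabilityMeasure μ] (hq : q ∈ Set.Ioo (-1 : ℝ) 1)
    (h : IsQOUProcess q X μ) : IsReversibleMarkov X μ (law q) (eratio q) where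
  measurable := h.measurable
  map_eq := h.marginal
  measurable_ratio δ hδ := measurable_eratio hq hδ
  symm δ x y := by rw [eratio, eratio, clampedRatio_symm]
  markov s t hst A hA G hG := by
    have := h.isProbabilityMeasure_law
    have hδ : 0 < t - s := tsub_pos_of_lt hst
    obtain ⟨C, hC⟩ := exists_setLIntegral_eratio_le hq hδ A
    have measurable_kernel : Measurable fun ω => ∫⁻ y in A, eratio q (t - s) (X s ω) y ∂(law q) :=
      (measurable_eratio hq hδ).lintegral_prod_right'.comp (h.measurable s)
    have kernel_ne_top :
        ∫⁻ ω in G, ∫⁻ y in A, eratio q (t - s) (X s ω) y ∂(law q) ∂μ ≠ ∞ := by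
      refine ne_top_of_le_ne_top ?_ (lintegral_mono fun ω => hC (X s ω))
      rw [lintegral_const]
      exact ENNReal.mul_ne_top ENNReal.ofReal_ne_top (measure_ne_top _ _)
    refine ((ENNReal.toReal_eq_toReal_iff' kernel_ne_top (measure_ne_top _ _)).1 ?_).symm
    rw [← integral_toReal measurable_kernel.aemeasurable
      (ae_of_all _ fun ω => (hC _).trans_lt ENNReal.ofReal_lt_top)]
    exact h.setIntegral_kernel hq hst hA hG

end IsQOUProcess

end QOUMarkov

/-! ### Jumps of càdlàg paths along dyadic partitions -/

/-- The path `f` jumps from below `-b` to above `b` at some time in `(u, v]`. -/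
def HasJump (f : ℝ≥0 → ℝ) (b : ℝ) (u v : ℝ≥0) : Prop :=
  ∃ t ∈ Set.Ioc u v, Function.leftLim f t < -b ∧ b < f t

/-- The `k`-th point of the partition of `[u, u + h]` into `2 ^ n` intervals. -/
def grid (u h : ℝ≥0) (n k : ℕ) : ℝ≥0 := u + h * k / 2 ^ n

/-- Some step of the `n`-th partition of `[u, u + h]` goes from below `-b` to above `b`. -/
def HasGridJump (f : ℝ≥0 → ℝ) (b : ℝ) (u h : ℝ≥0) (n : ℕ) : Prop :=
  ∃ k < 2 ^ n, f (grid u h n k) < -b ∧ b < f (grid u h n (k + 1))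

section Grid

variable {u h t : ℝ≥0} {n k : ℕ}

lemma grid_zero (u h : ℝ≥0) (n : ℕ) : grid u h n 0 = u := by simp [grid]

lemma grid_pow (u h : ℝ≥0) (n : ℕ) : grid u h n (2 ^ n) = u + h := by simp [grid]

lemma grid_mono (u h : ℝ≥0) (n : ℕ) : Monotone (grid u h n) := fun j k hjk => by
  unfold grid
  gcongr

lemma le_grid (u h : ℝ≥0) (n k : ℕ) : u ≤ grid u h n k := le_self_add

lemma grid_le (hk : k ≤ 2 ^ n) : grid u h n k ≤ u + h :=
  (grid_mono u h n hk).trans_eq (grid_pow u h n)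

lemma grid_succ (u h : ℝ≥0) (n k : ℕ) : grid u h n (k + 1) = grid u h n k + h / 2 ^ n := by
  unfold grid
  push_cast
  ring

lemma grid_lt_succ (hh : 0 < h) (n k : ℕ) : grid u h n k < grid u h n (k + 1) := by
  rw [grid_succ]
  exact lt_add_of_pos_right _ (by positivity)

lemma exists_grid_lt_le (hut : u < t) (htv : t ≤ u + h) (n : ℕ) :
    ∃ k < 2 ^ n, grid u h n k < t ∧ t ≤ grid u h n (k + 1) := by
  classical
  have hex : ∃ j, t ≤ grid u h n j := ⟨2 ^ n, by rwa [grid_pow]⟩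
  have hle : Nat.find hex ≤ 2 ^ n := Nat.find_min' hex (by rwa [grid_pow])
  obtain ⟨k, hk⟩ : ∃ k, Nat.find hex = k + 1 := Nat.exists_eq_succ_of_ne_zero fun h0 =>
    hut.not_ge ((Nat.find_spec hex).trans_eq (by rw [h0, grid_zero]))
  exact ⟨k, by omega, not_le.1 (Nat.find_min hex (by omega)), hk ▸ Nat.find_spec hex⟩

lemma tendsto_mesh (h : ℝ≥0) : Tendsto (fun n : ℕ => h / 2 ^ n) atTop (𝓝 0) := by
  simpa [div_eq_mul_inv] using
    (NNReal.tendsto_pow_atTop_nhds_zero_of_lt_one (r := 2⁻¹) (by norm_num)).const_mul h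

end Grid

section Paths

variable {f : ℝ≥0 → ℝ} {b b' : ℝ} {u v h t : ℝ≥0}

lemma HasJump.mono_level (hb : b ≤ b') (hf : HasJump f b' u v) : HasJump f b u v :=
  let ⟨t, ht, hlt, hgt⟩ := hf
  ⟨t, ht, hlt.trans_le (neg_le_neg hb), hb.trans_lt hgt⟩

lemma hasJump_union {w : ℝ≥0} (huv : u ≤ v) (hvw : v ≤ w) :
    HasJump f b u w ↔ HasJump f b u v ∨ HasJump f b v w := by
  simp only [HasJump, ← Set.Ioc_union_Ioc_eq_Ioc huv hvw, Set.mem_union, or_and_right, exists_or]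

lemma IsCadlag.tendsto_leftLim (hf : IsCadlag f) (ht : 0 < t) :
    Tendsto f (𝓝[<] t) (𝓝 (Function.leftLim f t)) := by
  obtain ⟨l, hl⟩ := (hf t).2
  have : (𝓝[<] t).NeBot := nhdsLT_neBot_of_exists_lt ⟨0, ht⟩
  rwa [leftLim_eq_of_tendsto hl]

lemma HasJump.eventually_hasGridJump (hf : IsCadlag f) (hj : HasJump f b u (u + h)) :
    ∀ᶠ n in atTop, HasGridJump f b u h n := by
  obtain ⟨t, ⟨hut, htv⟩, hlt, hgt⟩ := hj
  obtain ⟨p, hpt, below⟩ := (mem_nhdsLT_iff_exists_Ioo_subset' hut.pos).1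
    ((hf.tendsto_leftLim hut.pos).eventually_lt_const hlt)
  obtain ⟨r, htr, above⟩ := mem_nhdsGE_iff_exists_Ico_subset.1 ((hf t).1.eventually_const_lt hgt)
  filter_upwards [(tendsto_mesh h).eventually_lt_const (tsub_pos_of_lt hpt),
    (tendsto_mesh h).eventually_lt_const (tsub_pos_of_lt htr)] with n hnp hnr
  obtain ⟨k, hk, hkt, htk⟩ := exists_grid_lt_le hut htv n
  refine ⟨k, hk, below ⟨?_, hkt⟩, above ⟨htk, ?_⟩⟩
  · rw [lt_tsub_iff_right] at hnp
    rw [grid_succ] at htk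
    exact lt_of_add_lt_add_right ((add_comm p _).trans_lt (hnp.trans_le htk))
  · rw [lt_tsub_iff_right, add_comm] at hnr
    exact (grid_succ u h n k).trans_lt ((add_lt_add_left hkt _).trans hnr)

lemma hasJump_of_forall_Ioo (hf : IsCadlag f) {p r : ℝ≥0} (hp : u ≤ p) (hr : r ≤ v) (hpr : p < r)
    (hb : b < b') (hI : ∀ x ∈ Set.Ioo p r, f x ≤ -b' ∧ b' ≤ f x) : HasJump f b u v := by
  obtain ⟨t, hpt, htr⟩ := exists_between hpr
  have : (𝓝[<] t).NeBot := nhdsLT_neBot_of_exists_lt ⟨0, hpt.pos⟩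
  have leftLim_le : Function.leftLim f t ≤ -b' := by
    refine le_of_tendsto (hf.tendsto_leftLim hpt.pos) ?_
    filter_upwards [Ioo_mem_nhdsLT hpt] with x hx
    exact (hI x ⟨hx.1, hx.2.trans htr⟩).1
  exact ⟨t, ⟨hp.trans_lt hpt, htr.le.trans hr⟩, leftLim_le.trans_lt (neg_lt_neg hb),
    hb.trans_le (hI t ⟨hpt, htr⟩).2⟩

lemma hasJump_of_leftLim (hf : IsCadlag f) (hut : u < t) (htv : t ≤ v) (hb : b < b')
    (hle : Function.leftLim f t ≤ -b') (hge : b' ≤ Function.leftLim f t) : HasJump f b u v := by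
  obtain ⟨c, hbc, hcb⟩ := exists_between hb
  have hlim := hf.tendsto_leftLim hut.pos
  obtain ⟨p, hp, near⟩ := (mem_nhdsLT_iff_exists_Ioo_subset' hut).1
    ((hlim.eventually_lt_const (hle.trans_lt (neg_lt_neg hcb))).and
      (hlim.eventually_const_lt (hcb.trans_le hge)))
  refine hasJump_of_forall_Ioo hf (le_max_right p u) htv (max_lt hp hut) hbc fun x hx => ?_
  have hfx := near ⟨(le_max_left _ _).trans_lt hx.1, hx.2⟩
  exact ⟨hfx.1.le, hfx.2.le⟩

lemma hasJump_of_rightLim (hf : IsCadlag f) (hut : u ≤ t) (htv : t < v) (hb : b < b')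
    (hle : f t ≤ -b') (hge : b' ≤ f t) : HasJump f b u v := by
  obtain ⟨c, hbc, hcb⟩ := exists_between hb
  have hlim := (hf t).1.tendsto
  obtain ⟨r, hr, near⟩ := (mem_nhdsGE_iff_exists_Ico_subset' htv).1
    ((hlim.eventually_lt_const (hle.trans_lt (neg_lt_neg hcb))).and
      (hlim.eventually_const_lt (hcb.trans_le hge)))
  refine hasJump_of_forall_Ioo hf hut (min_le_right r v) (lt_min hr htv) hbc fun x hx => ?_
  have hfx := near ⟨hx.1.le, hx.2.trans_le (min_le_left _ _)⟩
  exact ⟨hfx.1.le, hfx.2.le⟩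

/-- Along the ultrafilter, each of `x` and `y` stays on one side of `t`. If they straddle `t`, the
jump is at `t`. Otherwise `f (x i)` and `f (y i)` have the same limit, which is possible only for
`b' ≤ 0`, and then times close to `t` on that side count as jumps. -/
lemma hasJump_of_tendsto (hf : IsCadlag f) (hb : b < b') {ι : Type*} {l : Ultrafilter ι}
    {x y : ι → ℝ≥0} (hx : Tendsto x l (𝓝 t)) (hy : Tendsto y l (𝓝 t))
    (hux : ∀ᶠ i in l, u ≤ x i) (hxy : ∀ᶠ i in l, x i < y i) (hyv : ∀ᶠ i in l, y i ≤ v)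
    (hfx : ∀ᶠ i in l, f (x i) ≤ -b') (hfy : ∀ᶠ i in l, b' ≤ f (y i)) : HasJump f b u v := by
  have htv : t ≤ v := le_of_tendsto hy hyv
  have hut : u ≤ t := ge_of_tendsto hx hux
  have from_left (ht : 0 < t) {z : ι → ℝ≥0} (hz : Tendsto z l (𝓝 t)) (hzt : ∀ᶠ i in l, z i < t) :
      Tendsto (fun i => f (z i)) l (𝓝 (Function.leftLim f t)) :=
    (hf.tendsto_leftLim ht).comp (tendsto_nhdsWithin_iff.2 ⟨hz, hzt⟩)
  have from_right {z : ι → ℝ≥0} (hz : Tendsto z l (𝓝 t)) (htz : ∀ᶠ i in l, t ≤ z i) :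
      Tendsto (fun i => f (z i)) l (𝓝 (f t)) :=
    (hf t).1.tendsto.comp (tendsto_nhdsWithin_iff.2 ⟨hz, htz⟩)
  rcases l.em fun i => x i < t with x_lt | x_ge
  · obtain ⟨i, hi, hi'⟩ := (hux.and x_lt).exists
    have hut' : u < t := hi.trans_lt hi'
    have hle : Function.leftLim f t ≤ -b' := le_of_tendsto (from_left hut'.pos hx x_lt) hfx
    rcases l.em fun i => y i < t with y_lt | y_ge
    · exact hasJump_of_leftLim hf hut' htv hb hle
        (ge_of_tendsto (from_left hut'.pos hy y_lt) hfy)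
    · have hge : b' ≤ f t := ge_of_tendsto (from_right hy (y_ge.mono fun _ => not_lt.1)) hfy
      exact ⟨t, ⟨hut', htv⟩, hle.trans_lt (neg_lt_neg hb), hb.trans_le hge⟩
  · have x_ge' : ∀ᶠ i in l, t ≤ x i := x_ge.mono fun _ => not_lt.1
    have y_gt : ∀ᶠ i in l, t < y i := (x_ge'.and hxy).mono fun i hi => hi.1.trans_lt hi.2
    obtain ⟨i, hi, hi'⟩ := (y_gt.and hyv).exists
    exact hasJump_of_rightLim hf hut (hi.trans_le hi') hb (le_of_tendsto (from_right hx x_ge') hfx)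
      (ge_of_tendsto (from_right hy (y_gt.mono fun _ => le_of_lt)) hfy)

lemma hasJump_of_frequently (hf : IsCadlag f) (hh : 0 < h) (hb : b < b')
    (hj : ∃ᶠ n in atTop, HasGridJump f b' u h n) : HasJump f b u (u + h) := by
  have : (atTop ⊓ 𝓟 {n | HasGridJump f b' u h n}).NeBot := frequently_iff_neBot.1 hj
  obtain ⟨l, hl⟩ := Ultrafilter.exists_le (atTop ⊓ 𝓟 {n | HasGridJump f b' u h n})
  have l_le : (l : Filter ℕ) ≤ atTop := hl.trans inf_le_left
  have jump : ∀ᶠ n in (l : Filter ℕ), HasGridJump f b' u h n :=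
    le_principal_iff.1 (hl.trans inf_le_right)
  choose! k hk below above using fun n (hn : HasGridJump f b' u h n) => hn
  obtain ⟨t, -, hlim⟩ := (isCompact_Icc (a := u) (b := u + h)).ultrafilter_le_nhds
    (l.map fun n => grid u h n (k n))
    (le_principal_iff.2 (jump.mono fun n hn => ⟨le_grid _ _ _ _, grid_le (hk n hn).le⟩))
  have tendsto_start : Tendsto (fun n => grid u h n (k n)) l (𝓝 t) := hlim
  have tendsto_end : Tendsto (fun n => grid u h n (k n + 1)) l (𝓝 t) := by
    simpa only [grid_succ, add_zero] using tendsto_start.add ((tendsto_mesh h).mono_left l_le)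
  exact hasJump_of_tendsto hf hb tendsto_start tendsto_end
    (Eventually.of_forall fun n => le_grid _ _ _ _)
    (Eventually.of_forall fun n => grid_lt_succ hh n (k n))
    (jump.mono fun n hn => grid_le (hk n hn)) (jump.mono fun n hn => (below n hn).le)
    (jump.mono fun n hn => (above n hn).le)

lemma hasJump_iff (hf : IsCadlag f) (hh : 0 < h) :
    HasJump f b u (u + h) ↔
      ∃ m : ℕ, ∀ᶠ n in atTop, HasGridJump f (b + 1 / (m + 1)) u h n := by
  constructor
  · rintro ⟨t, ht, hlt, hgt⟩
    obtain ⟨m, hm⟩ := exists_nat_one_div_lt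
      (show 0 < min (-b - Function.leftLim f t) (f t - b) from lt_min (by linarith) (by linarith))
    rw [lt_min_iff] at hm
    exact ⟨m, HasJump.eventually_hasGridJump hf ⟨t, ht, by linarith, by linarith⟩⟩
  · rintro ⟨m, hm⟩
    exact hasJump_of_frequently hf hh (lt_add_of_pos_right b Nat.one_div_pos_of_nat) hm.frequently

end Paths

/-! ### Jump events -/

section Measure

variable {Ω : Type*} [MeasurableSpace Ω] {μ : Measure Ω} [IsFiniteMeasure μ] {S : Set Ω}
  {T : ℕ → Set Ω} {c : ℝ}

lemma measureReal_le_of_eventually_mem (hS : ∀ ω ∈ S, ∀ᶠ n in atTop, ω ∈ T n)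
    (hT : ∀ n, μ.real (T n) ≤ c) : μ.real S ≤ c := by
  have subset_liminf : S ⊆ ⋃ N, ⋂ n ≥ N, T n := fun ω hω => by
    simpa only [Set.mem_iUnion, Set.mem_iInter] using eventually_atTop.1 (hS ω hω)
  have tendsto_liminf : Tendsto (fun N => μ.real (⋂ n ≥ N, T n)) atTop
      (𝓝 (μ.real (⋃ N, ⋂ n ≥ N, T n))) :=
    (ENNReal.tendsto_toReal (measure_ne_top _ _)).comp (tendsto_measure_iUnion_atTop
      fun N N' hN => Set.biInter_mono (fun n hn => le_trans hN hn) fun _ _ => le_rfl)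
  exact (measureReal_mono subset_liminf).trans (le_of_tendsto' tendsto_liminf fun N =>
    (measureReal_mono (Set.biInter_subset_of_mem le_rfl)).trans (hT N))

lemma le_measureReal_of_frequently_mem (hTm : ∀ n, MeasurableSet (T n))
    (hS : ∀ ω, (∃ᶠ n in atTop, ω ∈ T n) → ω ∈ S) (hT : ∀ n, c ≤ μ.real (T n)) :
    c ≤ μ.real S := by
  have limsup_subset : ⋂ N, ⋃ n ≥ N, T n ⊆ S := fun ω hω => hS ω (frequently_atTop.2 fun N => by
    simpa only [Set.mem_iUnion, exists_prop] using Set.mem_iInter.1 hω N)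
  have tendsto_limsup : Tendsto (fun N => μ.real (⋃ n ≥ N, T n)) atTop
      (𝓝 (μ.real (⋂ N, ⋃ n ≥ N, T n))) :=
    (ENNReal.tendsto_toReal (measure_ne_top _ _)).comp (tendsto_measure_iInter_atTop
      (fun N => (MeasurableSet.iUnion fun n =>
        MeasurableSet.iUnion fun _ => hTm n).nullMeasurableSet)
      (fun N N' hN => Set.biUnion_mono (fun n hn => le_trans hN hn) fun _ _ => le_rfl)
      ⟨0, measure_ne_top _ _⟩)
  exact (ge_of_tendsto' tendsto_limsup fun N => (hT N).trans
    (measureReal_mono (Set.subset_biUnion_of_mem (u := T) (le_refl N))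
      (measure_ne_top _ _))).trans (measureReal_mono limsup_subset)

lemma sum_measureReal_le_union_add (hT : ∀ k, MeasurableSet (T k)) (N : ℕ) :
    ∑ k ∈ Finset.range N, μ.real (T k) ≤ μ.real (⋃ k ∈ Finset.range N, T k) +
      ∑ k ∈ Finset.range N, ∑ j ∈ Finset.range k, μ.real (T j ∩ T k) := by
  induction N with
  | zero => simp
  | succ N ih =>
    have union_inter := measureReal_union_add_inter (μ := μ)
      (s := ⋃ k ∈ Finset.range N, T k) (hT N) (measure_ne_top _ _) (measure_ne_top _ _)
    have inter_le : μ.real ((⋃ k ∈ Finset.range N, T k) ∩ T N) ≤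
        ∑ j ∈ Finset.range N, μ.real (T j ∩ T N) := by
      rw [Set.iUnion₂_inter]
      exact measureReal_biUnion_finset_le _ _
    rw [Finset.sum_range_succ, Finset.sum_range_succ, Finset.range_add_one,
      Finset.set_biUnion_insert, Set.union_comm]
    linarith

lemma tendsto_measureReal_Ioi {π : Measure ℝ} [IsFiniteMeasure π] {x : ℕ → ℝ} {b : ℝ}
    (hx : Antitone x) (hb : Tendsto x atTop (𝓝 b)) :
    Tendsto (fun n => π.real (Set.Ioi (x n))) atTop (𝓝 (π.real (Set.Ioi b))) := by
  rw [← (isGLB_of_tendsto_atTop hx hb).iUnion_Ioi_eq]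
  exact (ENNReal.tendsto_toReal (measure_ne_top _ _)).comp
    (tendsto_measure_iUnion_atTop fun m n hmn => Set.Ioi_subset_Ioi (hx hmn))

lemma tendsto_measureReal_Iio {π : Measure ℝ} [IsFiniteMeasure π] {x : ℕ → ℝ} {b : ℝ}
    (hx : Monotone x) (hb : Tendsto x atTop (𝓝 b)) :
    Tendsto (fun n => π.real (Set.Iio (x n))) atTop (𝓝 (π.real (Set.Iio b))) := by
  rw [← (isLUB_of_tendsto_atTop hx hb).iUnion_Iio_eq]
  exact (ENNReal.tendsto_toReal (measure_ne_top _ _)).comp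
    (tendsto_measure_iUnion_atTop fun m n hmn => Set.Iio_subset_Iio (hx hmn))

end Measure

/-- The event that `X` jumps from below `-b` to above `b` in `(u, v]`. -/
def jumpEvent {Ω : Type*} (X : ℝ≥0 → Ω → ℝ) (b : ℝ) (u v : ℝ≥0) : Set Ω :=
  {ω | HasJump (fun t => X t ω) b u v}

/-- The event that `X` goes from below `-b` at time `s` to above `b` at time `t`. -/
def stepEvent {Ω : Type*} (X : ℝ≥0 → Ω → ℝ) (b : ℝ) (s t : ℝ≥0) : Set Ω :=
  X s ⁻¹' Set.Iio (-b) ∩ X t ⁻¹' Set.Ioi b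

/-- The event that `X` has a jump along the `n`-th partition of `[u, u + h]`. -/
def gridEvent {Ω : Type*} (X : ℝ≥0 → Ω → ℝ) (b : ℝ) (u h : ℝ≥0) (n : ℕ) : Set Ω :=
  ⋃ k ∈ Finset.range (2 ^ n), stepEvent X b (grid u h n k) (grid u h n (k + 1))

section Events

variable {Ω : Type*} {m : MeasurableSpace Ω} {X : ℝ≥0 → Ω → ℝ} {b : ℝ} {s t u v w h : ℝ≥0} {n : ℕ}

lemma mem_gridEvent {ω : Ω} :
    ω ∈ gridEvent X b u h n ↔ HasGridJump (fun t => X t ω) b u h n := by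
  simp [gridEvent, stepEvent, HasGridJump, and_left_comm]

lemma jumpEvent_union (huv : u ≤ v) (hvw : v ≤ w) :
    jumpEvent X b u w = jumpEvent X b u v ∪ jumpEvent X b v w :=
  Set.ext fun _ => hasJump_union huv hvw

lemma measurableSet_stepEvent (hs : Measurable[m] (X s)) (ht : Measurable[m] (X t)) :
    MeasurableSet[m] (stepEvent X b s t) :=
  (hs measurableSet_Iio).inter (ht measurableSet_Ioi)

lemma measurableSet_gridEvent (hX : ∀ t ∈ Set.Icc u (u + h), Measurable[m] (X t)) :
    MeasurableSet[m] (gridEvent X b u h n) :=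
  Finset.measurableSet_biUnion _ fun k hk =>
    have hk : k < 2 ^ n := Finset.mem_range.1 hk
    measurableSet_stepEvent (hX _ ⟨le_grid _ _ _ _, grid_le hk.le⟩)
      (hX _ ⟨le_grid _ _ _ _, grid_le hk⟩)

lemma measurableSet_jumpEvent (hc : ∀ ω, IsCadlag fun t => X t ω) (hh : 0 < h)
    (hX : ∀ t ∈ Set.Icc u (u + h), Measurable[m] (X t)) :
    MeasurableSet[m] (jumpEvent X b u (u + h)) := by
  have eq_iUnion : jumpEvent X b u (u + h) = ⋃ m : ℕ, ⋃ N : ℕ, ⋂ n : ℕ, ⋂ _ : N ≤ n,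
      gridEvent X (b + 1 / (m + 1)) u h n := by
    ext ω
    simp only [jumpEvent, Set.mem_ofPred_eq, hasJump_iff (hc ω) hh, eventually_atTop,
      Set.mem_iUnion, Set.mem_iInter, mem_gridEvent]
  rw [eq_iUnion]
  exact MeasurableSet.iUnion fun m => MeasurableSet.iUnion fun N =>
    MeasurableSet.iInter fun n => MeasurableSet.iInter fun _ => measurableSet_gridEvent hX

lemma measurableSet_jumpEvent_past (hc : ∀ ω, IsCadlag fun t => X t ω) (hh : 0 < h) :
    MeasurableSet[past X (u + h)] (jumpEvent X b u (u + h)) :=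
  measurableSet_jumpEvent hc hh fun _ ht => measurable_past ht.2

lemma measurableSet_jumpEvent_future (hc : ∀ ω, IsCadlag fun t => X t ω) (hh : 0 < h) :
    MeasurableSet[future X u] (jumpEvent X b u (u + h)) :=
  measurableSet_jumpEvent hc hh fun _ ht => measurable_future ht.1

end Events

/-! ### Probabilities of jumps -/

/-- Two-sided bounds on a density ratio: `r δ` is at least `k δ` for `δ ≤ 1`, at most `K` for
`δ ≥ 1 / 2`, and at most `K min(δ, 1)` for pairs that are separated by `[-b₀, b₀]`. -/
structure RatioBounds (r : ℝ≥0 → ℝ → ℝ → ℝ≥0∞) (b₀ k K : ℝ) : Prop where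
  lower_pos : 0 < k
  upper_pos : 0 < K
  level_nonneg : 0 ≤ b₀
  lower : ∀ (δ : ℝ≥0) x y, δ ≤ 1 → ENNReal.ofReal (k * δ) ≤ r δ x y
  upper : ∀ (δ : ℝ≥0) x y, 1 / 2 ≤ δ → r δ x y ≤ ENNReal.ofReal K
  far : ∀ (δ : ℝ≥0) x y, x < -b₀ → b₀ < y → r δ x y ≤ ENNReal.ofReal (K * min δ 1)

/-- The product of the two tail masses of `π` beyond `±b`, the order of magnitude of the probability
of a jump from below `-b` to above `b` in a unit of time. -/
def tailProd (π : Measure ℝ) (b : ℝ) : ℝ := π.real (Set.Iio (-b)) * π.real (Set.Ioi b)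

lemma tailProd_nonneg (π : Measure ℝ) (b : ℝ) : 0 ≤ tailProd π b :=
  mul_nonneg measureReal_nonneg measureReal_nonneg

lemma tendsto_tailProd (π : Measure ℝ) [IsFiniteMeasure π] {x : ℕ → ℝ} {b : ℝ}
    (hx : Antitone x) (hb : Tendsto x atTop (𝓝 b)) :
    Tendsto (fun n => tailProd π (x n)) atTop (𝓝 (tailProd π b)) :=
  (tendsto_measureReal_Iio hx.neg hb.neg).mul (tendsto_measureReal_Ioi hx hb)

lemma sum_range_le_of_le_div {f : ℕ → ℝ} {c : ℝ} {n i : ℕ} (hc : 0 ≤ c) (hi : i ≤ 2 ^ n)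
    (hf : ∀ j < i, f j ≤ c / 2 ^ n) : ∑ j ∈ Finset.range i, f j ≤ c :=
  calc ∑ j ∈ Finset.range i, f j ≤ i * (c / 2 ^ n) := by
        simpa using Finset.sum_le_card_nsmul (Finset.range i) f _
          fun j hj => hf j (Finset.mem_range.1 hj)
    _ ≤ 2 ^ n * (c / 2 ^ n) := by
        gcongr
        exact_mod_cast hi
    _ = c := mul_div_cancel₀ c (by positivity)

lemma le_sum_range_of_div_le {f : ℕ → ℝ} {c : ℝ} {n : ℕ} (hf : ∀ j < 2 ^ n, c / 2 ^ n ≤ f j) :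
    c ≤ ∑ j ∈ Finset.range (2 ^ n), f j :=
  calc c = 2 ^ n * (c / 2 ^ n) := (mul_div_cancel₀ c (by positivity)).symm
    _ ≤ ∑ j ∈ Finset.range (2 ^ n), f j := by
        simpa using Finset.card_nsmul_le_sum (Finset.range (2 ^ n)) f _
          fun j hj => hf j (Finset.mem_range.1 hj)

lemma grid_succ_sub (u h : ℝ≥0) (n k : ℕ) : grid u h n (k + 1) - grid u h n k = h / 2 ^ n := by
  rw [grid_succ, add_tsub_cancel_left]

namespace IsReversibleMarkov

section Real

variable {Ω E : Type*} [MeasurableSpace Ω] [MeasurableSpace E] {X : ℝ≥0 → Ω → E} {μ : Measure Ω}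
  {π : Measure E} {r : ℝ≥0 → E → E → ℝ≥0∞} {s t : ℝ≥0} {G H : Set Ω}

lemma measureReal_preimage (hX : IsReversibleMarkov X μ π r) (t : ℝ≥0) {A : Set E}
    (hA : MeasurableSet A) : μ.real (X t ⁻¹' A) = π.real A :=
  congrArg ENNReal.toReal (hX.measure_preimage t hA)

variable [IsFiniteMeasure μ] [SFinite π]

lemma measureReal_inter_le (hX : IsReversibleMarkov X μ π r) (hst : s < t)
    (hG : MeasurableSet[past X s] G) (hH : MeasurableSet[future X t] H) {C : ℝ} (hC0 : 0 ≤ C)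
    (hC : ∀ ω' ∈ G, ∀ ω ∈ H, r (t - s) (X s ω') (X t ω) ≤ ENNReal.ofReal C) :
    μ.real (G ∩ H) ≤ C * μ.real G * μ.real H := by
  have hle := ENNReal.toReal_mono (by finiteness) (hX.measure_inter_le hst hG hH hC)
  rwa [ENNReal.toReal_mul, ENNReal.toReal_mul, ENNReal.toReal_ofReal hC0] at hle

lemma le_measureReal_inter (hX : IsReversibleMarkov X μ π r) (hst : s < t)
    (hG : MeasurableSet[past X s] G) (hH : MeasurableSet[future X t] H) {c : ℝ} (hc0 : 0 ≤ c)
    (hc : ∀ ω' ∈ G, ∀ ω ∈ H, ENNReal.ofReal c ≤ r (t - s) (X s ω') (X t ω)) :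
    c * μ.real G * μ.real H ≤ μ.real (G ∩ H) := by
  have hle := ENNReal.toReal_mono (measure_ne_top _ _) (hX.le_measure_inter hst hG hH hc)
  rwa [ENNReal.toReal_mul, ENNReal.toReal_mul, ENNReal.toReal_ofReal hc0] at hle

end Real

variable {Ω : Type*} [MeasurableSpace Ω] {X : ℝ≥0 → Ω → ℝ} {μ : Measure Ω} [IsFiniteMeasure μ]
  {π : Measure ℝ} {r : ℝ≥0 → ℝ → ℝ → ℝ≥0∞} {s t s' t' u v h h' : ℝ≥0} {b b₀ k K : ℝ} {H : Set Ω}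

lemma measureReal_stepEvent_inter_le [SFinite π] (hX : IsReversibleMarkov X μ π r)
    (hr : RatioBounds r b₀ k K) (hb : b₀ ≤ b) (hst : s < t) (hH : MeasurableSet[future X t] H) :
    μ.real (stepEvent X b s t ∩ H) ≤
      K * (t - s : ℝ≥0) * π.real (Set.Iio (-b)) * μ.real (X t ⁻¹' Set.Ioi b ∩ H) := by
  rw [stepEvent, Set.inter_assoc, ← hX.measureReal_preimage s measurableSet_Iio]
  refine hX.measureReal_inter_le hst (measurable_past le_rfl measurableSet_Iio)
    ((measurable_future le_rfl measurableSet_Ioi).inter hH)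
    (mul_nonneg hr.upper_pos.le (NNReal.coe_nonneg _)) fun ω' hω' ω hω => ?_
  refine (hr.far _ _ _ (hω'.trans_le (neg_le_neg hb)) (hb.trans_lt hω.1)).trans
    (ENNReal.ofReal_le_ofReal ?_)
  exact mul_le_mul_of_nonneg_left (min_le_left _ _) hr.upper_pos.le

lemma measureReal_stepEvent_le [SFinite π] (hX : IsReversibleMarkov X μ π r)
    (hr : RatioBounds r b₀ k K) (hb : b₀ ≤ b) (hst : s < t) :
    μ.real (stepEvent X b s t) ≤ K * (t - s : ℝ≥0) * tailProd π b := by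
  simpa only [Set.inter_univ, hX.measureReal_preimage t measurableSet_Ioi, mul_assoc, tailProd]
    using hX.measureReal_stepEvent_inter_le hr hb hst MeasurableSet.univ

lemma le_measureReal_stepEvent [SFinite π] (hX : IsReversibleMarkov X μ π r)
    (hr : RatioBounds r b₀ k K) (hst : s < t) (hst1 : t - s ≤ 1) :
    k * (t - s : ℝ≥0) * tailProd π b ≤ μ.real (stepEvent X b s t) := by
  rw [tailProd, ← hX.measureReal_preimage s measurableSet_Iio,
    ← hX.measureReal_preimage t measurableSet_Ioi, ← mul_assoc]
  exact hX.le_measureReal_inter hst (measurable_past le_rfl measurableSet_Iio)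
    (measurable_future le_rfl measurableSet_Ioi)
    (mul_nonneg hr.lower_pos.le (NNReal.coe_nonneg _)) fun _ _ _ _ => hr.lower _ _ _ hst1

/-- Between two steps up, the process has to come back down from above `b` to below `-b`. -/
lemma measureReal_stepEvent_inter_stepEvent_le [SFinite π] (hX : IsReversibleMarkov X μ π r)
    (hr : RatioBounds r b₀ k K) (hb : b₀ ≤ b) (hst : s < t) (hts : t ≤ s') (hst' : s' < t') :
    μ.real (stepEvent X b s t ∩ stepEvent X b s' t') ≤
      K ^ 3 * (t - s : ℝ≥0) * (t' - s' : ℝ≥0) * tailProd π b ^ 2 := by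
  have hK := hr.upper_pos
  have hP := tailProd_nonneg π b
  rcases hts.eq_or_lt with rfl | hlt
  · have disjoint : stepEvent X b s t ∩ stepEvent X b t t' = ∅ :=
      Set.eq_empty_of_forall_notMem fun ω ⟨⟨_, (above : b < X t ω)⟩, (below : X t ω < -b), _⟩ => by
        linarith [hr.level_nonneg]
    rw [disjoint, measureReal_empty]
    positivity
  · have step_past : MeasurableSet[past X t] (stepEvent X b s t) :=
      measurableSet_stepEvent (measurable_past hst.le) (measurable_past le_rfl)
    have step_future : MeasurableSet[future X s'] (stepEvent X b s' t') :=
      measurableSet_stepEvent (measurable_future le_rfl) (measurable_future hst'.le)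
    calc μ.real (stepEvent X b s t ∩ stepEvent X b s' t')
        ≤ K * μ.real (stepEvent X b s t) * μ.real (stepEvent X b s' t') := by
          refine hX.measureReal_inter_le hlt step_past step_future hK.le fun ω' hω' ω hω => ?_
          rw [hX.symm]
          refine (hr.far _ _ _ (hω.1.trans_le (neg_le_neg hb)) (hb.trans_lt hω'.2)).trans
            (ENNReal.ofReal_le_ofReal ?_)
          exact mul_le_of_le_one_right hK.le (min_le_right _ _)
      _ ≤ K * (K * (t - s : ℝ≥0) * tailProd π b) * (K * (t' - s' : ℝ≥0) * tailProd π b) := by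
          gcongr
          · exact hX.measureReal_stepEvent_le hr hb hst
          · exact hX.measureReal_stepEvent_le hr hb hst'
      _ = K ^ 3 * (t - s : ℝ≥0) * (t' - s' : ℝ≥0) * tailProd π b ^ 2 := by ring

lemma measureReal_gridEvent_inter_le [SFinite π] (hX : IsReversibleMarkov X μ π r)
    (hr : RatioBounds r b₀ k K) (hb : b₀ ≤ b) (hh : 0 < h) (hH : MeasurableSet[future X (u + h)] H)
    (n : ℕ) :
    μ.real (gridEvent X b u h n ∩ H) ≤ K * h * π.real (Set.Iio (-b)) * μ.real H := by
  have hK := hr.upper_pos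
  rw [gridEvent, Set.iUnion₂_inter]
  refine (measureReal_biUnion_finset_le _ _).trans
    (sum_range_le_of_le_div (by positivity) le_rfl fun j hj => ?_)
  calc μ.real (stepEvent X b (grid u h n j) (grid u h n (j + 1)) ∩ H)
      ≤ K * (h / 2 ^ n : ℝ≥0) * π.real (Set.Iio (-b)) *
          μ.real (X (grid u h n (j + 1)) ⁻¹' Set.Ioi b ∩ H) := by
        rw [← grid_succ_sub]
        exact hX.measureReal_stepEvent_inter_le hr hb (grid_lt_succ hh n j)
          (future_anti (grid_le hj) _ hH)
    _ ≤ K * (h / 2 ^ n : ℝ≥0) * π.real (Set.Iio (-b)) * μ.real H := by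
        gcongr
        · exact measure_ne_top μ H
        · exact Set.inter_subset_right
    _ = K * h * π.real (Set.Iio (-b)) * μ.real H / 2 ^ n := by
        push_cast
        ring

lemma measureReal_jumpEvent_inter_le [SFinite π] (hX : IsReversibleMarkov X μ π r)
    (hr : RatioBounds r b₀ k K) (hc : ∀ ω, IsCadlag fun t => X t ω) (hb : b₀ ≤ b) (hh : 0 < h)
    (hH : MeasurableSet[future X (u + h)] H) :
    μ.real (jumpEvent X b u (u + h) ∩ H) ≤ K * h * π.real (Set.Iio (-b)) * μ.real H :=
  measureReal_le_of_eventually_mem (T := fun n => gridEvent X b u h n ∩ H)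
    (fun ω hω => (HasJump.eventually_hasGridJump (hc ω) hω.1).mono
      fun _ hn => ⟨mem_gridEvent.2 hn, hω.2⟩)
    (hX.measureReal_gridEvent_inter_le hr hb hh hH)

lemma measureReal_gridEvent_inter_gridEvent_le [SFinite π] (hX : IsReversibleMarkov X μ π r)
    (hr : RatioBounds r b₀ k K) (hb : b₀ ≤ b) (hh : 0 < h) (huv : u + h ≤ v) (hh' : 0 < h')
    (n : ℕ) :
    μ.real (gridEvent X b u h n ∩ gridEvent X b v h' n) ≤
      K ^ 3 * h * h' * tailProd π b ^ 2 := by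
  have hK := hr.upper_pos
  rw [gridEvent, Set.iUnion₂_inter]
  refine (measureReal_biUnion_finset_le _ _).trans
    (sum_range_le_of_le_div (by positivity) le_rfl fun j hj => ?_)
  rw [gridEvent, Set.inter_iUnion₂]
  refine (measureReal_biUnion_finset_le _ _).trans
    (sum_range_le_of_le_div (by positivity) le_rfl fun i _ => ?_)
  refine (hX.measureReal_stepEvent_inter_stepEvent_le hr hb (grid_lt_succ hh n j)
    ((grid_le hj).trans (huv.trans (le_grid v h' n i))) (grid_lt_succ hh' n i)).trans_eq ?_
  rw [grid_succ_sub, grid_succ_sub]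
  push_cast
  ring

lemma measureReal_jumpEvent_inter_jumpEvent_le [SFinite π] (hX : IsReversibleMarkov X μ π r)
    (hr : RatioBounds r b₀ k K) (hc : ∀ ω, IsCadlag fun t => X t ω) (hb : b₀ ≤ b) (hh : 0 < h)
    (huv : u + h ≤ v) (hh' : 0 < h') :
    μ.real (jumpEvent X b u (u + h) ∩ jumpEvent X b v (v + h')) ≤
      K ^ 3 * h * h' * tailProd π b ^ 2 := by
  refine measureReal_le_of_eventually_mem
    (T := fun n => gridEvent X b u h n ∩ gridEvent X b v h' n) (fun ω hω => ?_)
    (hX.measureReal_gridEvent_inter_gridEvent_le hr hb hh huv hh')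
  filter_upwards [HasJump.eventually_hasGridJump (hc ω) hω.1,
    HasJump.eventually_hasGridJump (hc ω) hω.2] with n hn hn'
  exact ⟨mem_gridEvent.2 hn, mem_gridEvent.2 hn'⟩

lemma le_measureReal_gridEvent [SFinite π] (hX : IsReversibleMarkov X μ π r)
    (hr : RatioBounds r b₀ k K) (hb : b₀ ≤ b) (hh : 0 < h) (hh1 : h ≤ 1) (n : ℕ) :
    k * h * tailProd π b - K ^ 3 * h ^ 2 * tailProd π b ^ 2 ≤ μ.real (gridEvent X b u h n) := by
  have hK := hr.upper_pos
  set step := fun j : ℕ => stepEvent X b (grid u h n j) (grid u h n (j + 1))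
  have bonferroni := sum_measureReal_le_union_add (μ := μ) (T := step)
    (fun j => measurableSet_stepEvent (hX.measurable _) (hX.measurable _)) (2 ^ n)
  have le_sum : k * h * tailProd π b ≤ ∑ j ∈ Finset.range (2 ^ n), μ.real (step j) :=
    le_sum_range_of_div_le fun j _ => by
      have mesh_le : grid u h n (j + 1) - grid u h n j ≤ 1 := by
        rw [grid_succ_sub]
        exact (div_le_self zero_le (one_le_pow₀ one_le_two)).trans hh1
      refine Eq.trans_le ?_ (hX.le_measureReal_stepEvent (b := b) hr (grid_lt_succ hh n j) mesh_le)
      rw [grid_succ_sub]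
      push_cast
      ring
  have sum_pairs_le : ∑ i ∈ Finset.range (2 ^ n), ∑ j ∈ Finset.range i, μ.real (step j ∩ step i) ≤
      K ^ 3 * h ^ 2 * tailProd π b ^ 2 :=
    sum_range_le_of_le_div (by positivity) le_rfl fun i hi =>
      sum_range_le_of_le_div (by positivity) hi.le fun j hj => by
        refine (hX.measureReal_stepEvent_inter_stepEvent_le hr hb (grid_lt_succ hh n j)
          (grid_mono u h n hj) (grid_lt_succ hh n i)).trans_eq ?_
        rw [grid_succ_sub, grid_succ_sub]
        push_cast
        ring
  change _ ≤ μ.real (⋃ j ∈ Finset.range (2 ^ n), step j)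
  linarith

/-- The levels `b + 1 / (m + 1)` make up for the strict inequality lost in the limit of grids. -/
lemma le_measureReal_jumpEvent [IsFiniteMeasure π] (hX : IsReversibleMarkov X μ π r)
    (hr : RatioBounds r b₀ k K) (hc : ∀ ω, IsCadlag fun t => X t ω) (hb : b₀ ≤ b) (hh : 0 < h)
    (hh1 : h ≤ 1) :
    k * h * tailProd π b - K ^ 3 * h ^ 2 * tailProd π b ^ 2 ≤
      μ.real (jumpEvent X b u (u + h)) := by
  have level_gt (m : ℕ) : b < b + 1 / ((m : ℝ) + 1) :=
    lt_add_of_pos_right b Nat.one_div_pos_of_nat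
  have tendsto_level : Tendsto (fun m : ℕ => b + 1 / ((m : ℝ) + 1)) atTop (𝓝 b) := by
    simpa using (tendsto_one_div_add_atTop_nhds_zero_nat (𝕜 := ℝ)).const_add b
  have antitone_level : Antitone fun m : ℕ => b + 1 / ((m : ℝ) + 1) := fun m m' hm =>
    add_le_add_right (Nat.one_div_le_one_div hm) b
  have tendsto_tail := tendsto_tailProd π antitone_level tendsto_level
  refine le_of_tendsto' ((tendsto_tail.const_mul (k * h)).sub
    ((tendsto_tail.pow 2).const_mul (K ^ 3 * h ^ 2))) fun m => ?_
  exact le_measureReal_of_frequently_mem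
    (fun n => measurableSet_gridEvent fun t _ => hX.measurable t)
    (fun ω hω => hasJump_of_frequently (hc ω) hh (level_gt m)
      (hω.mono fun n hn => mem_gridEvent.1 hn))
    (hX.le_measureReal_gridEvent hr (hb.trans (level_gt m).le) hh hh1)

end IsReversibleMarkov

/-! ### The probability of staying in a set -/

lemma sq_lintegral_le {α : Type*} [MeasurableSpace α] {π : Measure α} [IsProbabilityMeasure π]
    {f : α → ℝ≥0∞} (hf : AEMeasurable f π) : (∫⁻ x, f x ∂π) ^ 2 ≤ ∫⁻ x, f x ^ 2 ∂π := by
  have cauchy_schwarz := ENNReal.lintegral_mul_le_Lp_mul_Lq π Real.HolderConjugate.two_two hf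
    (g := 1) aemeasurable_const
  simp only [Pi.mul_apply, Pi.one_apply, mul_one, ENNReal.rpow_two, one_pow, lintegral_const,
    measure_univ, ENNReal.one_rpow] at cauchy_schwarz
  calc (∫⁻ x, f x ∂π) ^ 2 ≤ ((∫⁻ x, f x ^ 2 ∂π) ^ (1 / 2 : ℝ)) ^ 2 := by gcongr
    _ = ∫⁻ x, f x ^ 2 ∂π := by
        rw [← ENNReal.rpow_two, ← ENNReal.rpow_mul]
        norm_num

section Stay

variable {Ω E : Type*}

/-- The event that `X` is in `S` at the times `s + i δ`, `i ≤ n`. -/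
def stayEvent (X : ℝ≥0 → Ω → E) (S : Set E) (s δ : ℝ≥0) (n : ℕ) : Set Ω :=
  {ω | ∀ i ≤ n, X (s + i * δ) ω ∈ S}

section Events

variable {X : ℝ≥0 → Ω → E} {S : Set E} {s δ : ℝ≥0} {n : ℕ}

lemma stayEvent_zero : stayEvent X S s δ 0 = X s ⁻¹' S := by
  ext ω
  simp [stayEvent]

lemma stayEvent_add {m : ℕ} :
    stayEvent X S s δ (m + n) = stayEvent X S s δ m ∩ stayEvent X S (s + m * δ) δ n := by
  ext ω
  have shift (i : ℕ) : s + m * δ + i * δ = s + (m + i : ℕ) * δ := by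
    push_cast
    ring
  simp only [stayEvent, Set.mem_inter_iff, Set.mem_ofPred_eq, shift]
  refine ⟨fun stay => ⟨fun i hi => stay i (by omega), fun i hi => stay (m + i) (by omega)⟩,
    fun ⟨stay, stay'⟩ i hi => ?_⟩
  rcases le_total i m with him | hmi
  · exact stay i him
  · obtain ⟨j, rfl⟩ := Nat.exists_eq_add_of_le hmi
    exact stay' j (by omega)

lemma stayEvent_succ :
    stayEvent X S s δ (n + 1) = stayEvent X S s δ n ∩ X (s + (n + 1 : ℕ) * δ) ⁻¹' S := by
  ext ω
  simp only [stayEvent, Set.mem_ofPred_eq, ← Nat.lt_add_one_iff, Nat.forall_lt_succ_right]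
  rfl

lemma stayEvent_succ' :
    stayEvent X S s δ (n + 1) = X s ⁻¹' S ∩ stayEvent X S (s + δ) δ n := by
  ext ω
  have shift (i : ℕ) : s + δ + i * δ = s + (i + 1 : ℕ) * δ := by
    push_cast
    ring
  simp only [stayEvent, Set.mem_inter_iff, Set.mem_ofPred_eq, ← Nat.lt_add_one_iff,
    Nat.forall_lt_succ_left, shift]
  simp

lemma stayEvent_dyadic_anti : Antitone fun N => stayEvent X S s (1 / 2 ^ N) (2 ^ N) := by
  intro M N hMN ω hω i hi
  obtain ⟨d, rfl⟩ := Nat.exists_eq_add_of_le hMN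
  convert hω (i * 2 ^ d) (by rw [pow_add]; gcongr) using 3
  push_cast
  rw [pow_add]
  field_simp

lemma exists_stayEvent_dyadic [TopologicalSpace E] (hS : IsOpen S) {ω : Ω} (hω : X s ω ∈ S)
    (hright : ContinuousWithinAt (fun t => X t ω) (Set.Ici s) s) :
    ∃ M : ℕ, ∀ d : ℕ, ω ∈ stayEvent X S s (1 / 2 ^ (M + d)) (2 ^ d) := by
  obtain ⟨v, hv, stay⟩ := mem_nhdsGE_iff_exists_Ico_subset.1 (hright (hS.mem_nhds hω))
  obtain ⟨M, hM⟩ := ((tendsto_mesh 1).eventually_lt_const (tsub_pos_of_lt hv)).exists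
  refine ⟨M, fun d i hi => stay ⟨le_self_add, ?_⟩⟩
  rw [lt_tsub_iff_left] at hM
  refine lt_of_le_of_lt ?_ hM
  gcongr
  calc (i : ℝ≥0) * (1 / 2 ^ (M + d)) ≤ 2 ^ d * (1 / 2 ^ (M + d)) := by
        gcongr
        exact_mod_cast hi
    _ = 1 / 2 ^ M := by
        rw [pow_add]
        field_simp

variable [MeasurableSpace E]

lemma measurableSet_stayEvent {m : MeasurableSpace Ω} (hS : MeasurableSet S)
    (hX : ∀ i ≤ n, Measurable (X (s + i * δ))) : MeasurableSet (stayEvent X S s δ n) := by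
  simp only [stayEvent, Set.ofPred_forall]
  exact MeasurableSet.iInter fun i => MeasurableSet.iInter fun hi => hX i hi hS

lemma measurableSet_stayEvent_past (hS : MeasurableSet S) :
    MeasurableSet[past X (s + n * δ)] (stayEvent X S s δ n) :=
  measurableSet_stayEvent hS fun i hi => measurable_past (by gcongr)

lemma measurableSet_stayEvent_future (hS : MeasurableSet S) :
    MeasurableSet[future X s] (stayEvent X S s δ n) :=
  measurableSet_stayEvent hS fun _ _ => measurable_future le_self_add

end Events

variable [MeasurableSpace E]

/-- The density with respect to `π`, at the final time, of the event that a Markov process with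
density ratio `r` is in `S` at `n + 1` times which are `δ` apart. -/
def survive (π : Measure E) (r : ℝ≥0 → E → E → ℝ≥0∞) (S : Set E) (δ : ℝ≥0) : ℕ → E → ℝ≥0∞
  | 0 => S.indicator 1
  | n + 1 => S.indicator fun y => ∫⁻ x, r δ x y * survive π r S δ n x ∂π

/-- The probability that a process is in `S` at all dyadic times of the unit interval, expressed
through its law `π` and its density ratio `r` alone. -/
def stayProb (π : Measure E) (r : ℝ≥0 → E → E → ℝ≥0∞) (S : Set E) : ℝ≥0∞ :=
  ⨅ N : ℕ, ∫⁻ x, survive π r S (1 / 2 ^ N) (2 ^ N) x ∂π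

namespace IsReversibleMarkov

variable [MeasurableSpace Ω] {X : ℝ≥0 → Ω → E} {μ : Measure Ω} {π : Measure E}
  {r : ℝ≥0 → E → E → ℝ≥0∞} {S : Set E} {s δ : ℝ≥0} {G : Set Ω} {f g : E → ℝ≥0∞}

lemma setLIntegral_comp_of_density (hX : IsReversibleMarkov X μ π r)
    (hf : Measurable f) (hg : Measurable g)
    (hGf : ∀ A, MeasurableSet A → μ (G ∩ X s ⁻¹' A) = ∫⁻ y in A, f y ∂π) :
    ∫⁻ ω in G, g (X s ω) ∂μ = ∫⁻ y, g y * f y ∂π := by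
  have map_eq : (μ.restrict G).map (X s) = π.withDensity f := by
    ext A hA
    rw [Measure.map_apply (hX.measurable s) hA, withDensity_apply _ hA,
      Measure.restrict_apply (hX.measurable s hA), Set.inter_comm, hGf A hA]
  rw [← lintegral_map hg (hX.measurable s), map_eq,
    lintegral_withDensity_eq_lintegral_mul _ hf hg]
  exact lintegral_congr fun y => mul_comm _ _

lemma measurable_ratio_left (hX : IsReversibleMarkov X μ π r) (hδ : 0 < δ) (y : E) :
    Measurable fun x => r δ x y :=
  (hX.measurable_ratio δ hδ).comp (measurable_id.prodMk measurable_const)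

lemma measure_stayEvent_zero_inter (hX : IsReversibleMarkov X μ π r) (hS : MeasurableSet S)
    {A : Set E} (hA : MeasurableSet A) :
    μ (stayEvent X S s δ 0 ∩ X s ⁻¹' A) = ∫⁻ y in A, survive π r S δ 0 y ∂π := by
  rw [stayEvent_zero, ← Set.preimage_inter, hX.measure_preimage s (hS.inter hA), survive,
    lintegral_indicator_one hS, Measure.restrict_apply hS]

variable [SFinite π]

lemma measurable_survive (hX : IsReversibleMarkov X μ π r) (hS : MeasurableSet S) (hδ : 0 < δ)
    (n : ℕ) : Measurable (survive π r S δ n) := by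
  induction n with
  | zero => exact measurable_one.indicator hS
  | succ n ih =>
    have integrand : Measurable fun z : E × E => r δ z.2 z.1 * survive π r S δ n z.2 :=
      ((hX.measurable_ratio δ hδ).comp measurable_swap).mul (ih.comp measurable_snd)
    exact integrand.lintegral_prod_right'.indicator hS

lemma lintegral_kernel_mul (hX : IsReversibleMarkov X μ π r) (hδ : 0 < δ) (A : Set E)
    (hf : Measurable f) :
    ∫⁻ y, (∫⁻ x in A, r δ x y ∂π) * f y ∂π = ∫⁻ y in A, ∫⁻ x, r δ x y * f x ∂π ∂π :=
  calc ∫⁻ y, (∫⁻ x in A, r δ x y ∂π) * f y ∂π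
      = ∫⁻ y, ∫⁻ x in A, r δ x y * f y ∂π ∂π :=
        lintegral_congr fun y => (lintegral_mul_const _ (hX.measurable_ratio_left hδ y)).symm
    _ = ∫⁻ x in A, ∫⁻ y, r δ x y * f y ∂π ∂π :=
        lintegral_lintegral_swap (((hX.measurable_ratio δ hδ).comp measurable_swap).mul
          (hf.comp measurable_fst)).aemeasurable
    _ = ∫⁻ y in A, ∫⁻ x, r δ x y * f x ∂π ∂π :=
        lintegral_congr fun x => lintegral_congr fun y => by rw [hX.symm δ x y]

variable [IsFiniteMeasure μ]

lemma measure_stayEvent_inter_last (hX : IsReversibleMarkov X μ π r) (hS : MeasurableSet S)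
    (hδ : 0 < δ) (n : ℕ) : ∀ A, MeasurableSet A →
      μ (stayEvent X S s δ n ∩ X (s + n * δ) ⁻¹' A) = ∫⁻ y in A, survive π r S δ n y ∂π := by
  induction n with
  | zero => simpa using fun A hA => hX.measure_stayEvent_zero_inter hS hA
  | succ n ih =>
    intro A hA
    have next : s + (n + 1 : ℕ) * δ = s + n * δ + δ := by
      push_cast
      ring
    rw [stayEvent_succ, next, Set.inter_assoc, ← Set.preimage_inter,
      hX.measure_inter_preimage (lt_add_of_pos_right _ hδ) (measurableSet_stayEvent_past hS)
        (hS.inter hA), add_tsub_cancel_left, survive, setLIntegral_indicator hS]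
    exact lintegral_congr fun y => hX.setLIntegral_comp_of_density (hX.measurable_survive hS hδ n)
      (hX.measurable_ratio_left hδ y) ih

/-- By reversibility, `survive` is also the density of `stayEvent` at the initial time. -/
lemma measure_stayEvent_inter_first (hX : IsReversibleMarkov X μ π r) (hS : MeasurableSet S)
    (hδ : 0 < δ) (n : ℕ) : ∀ s A, MeasurableSet A →
      μ (stayEvent X S s δ n ∩ X s ⁻¹' A) = ∫⁻ y in A, survive π r S δ n y ∂π := by
  induction n with
  | zero => exact fun s A hA => hX.measure_stayEvent_zero_inter hS hA
  | succ n ih =>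
    intro s A hA
    have hSA := hS.inter hA
    have measurable_kernel : Measurable fun y => ∫⁻ x in S ∩ A, r δ x y ∂π :=
      ((hX.measurable_ratio δ hδ).comp measurable_swap).lintegral_prod_right'
    calc μ (stayEvent X S s δ (n + 1) ∩ X s ⁻¹' A)
        = μ (X s ⁻¹' (S ∩ A) ∩ stayEvent X S (s + δ) δ n) := by
          rw [stayEvent_succ', Set.inter_right_comm, Set.preimage_inter]
      _ = ∫⁻ ω in stayEvent X S (s + δ) δ n, ∫⁻ x in S ∩ A, r δ x (X (s + δ) ω) ∂π ∂μ := by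
          rw [hX.measure_inter_eq (lt_add_of_pos_right _ hδ) (measurable_past le_rfl hSA)
            (measurableSet_stayEvent_future hS), add_tsub_cancel_left]
          exact lintegral_congr fun ω =>
            hX.setLIntegral_comp s hSA (hX.measurable_ratio_left hδ _)
      _ = ∫⁻ y, (∫⁻ x in S ∩ A, r δ x y ∂π) * survive π r S δ n y ∂π :=
          hX.setLIntegral_comp_of_density (hX.measurable_survive hS hδ n) measurable_kernel
            (ih (s + δ))
      _ = ∫⁻ y in A, survive π r S δ (n + 1) y ∂π := by
          rw [hX.lintegral_kernel_mul hδ _ (hX.measurable_survive hS hδ n), survive,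
            setLIntegral_indicator hS]

lemma measure_stayEvent (hX : IsReversibleMarkov X μ π r) (hS : MeasurableSet S) (hδ : 0 < δ)
    (s : ℝ≥0) (n : ℕ) : μ (stayEvent X S s δ n) = ∫⁻ y, survive π r S δ n y ∂π := by
  simpa using hX.measure_stayEvent_inter_first hS hδ n s Set.univ MeasurableSet.univ

lemma stayProb_eq (hX : IsReversibleMarkov X μ π r) (hS : MeasurableSet S) (s : ℝ≥0) :
    stayProb π r S = μ (⋂ N : ℕ, stayEvent X S s (1 / 2 ^ N) (2 ^ N)) := by
  rw [stayEvent_dyadic_anti.measure_iInter (fun N =>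
      (hX.future_le _ _ (measurableSet_stayEvent_future hS)).nullMeasurableSet)
    ⟨0, measure_ne_top _ _⟩, stayProb]
  exact iInf_congr fun N => (hX.measure_stayEvent hS (by positivity) s _).symm

variable [IsProbabilityMeasure π]

/-- Cutting at the middle time, the two halves have the same density there. -/
lemma sq_measure_stayEvent_le (hX : IsReversibleMarkov X μ π r) (hS : MeasurableSet S)
    (hδ : 0 < δ) (n : ℕ) :
    μ (stayEvent X S s δ n) ^ 2 ≤ μ (stayEvent X S s δ (n + n)) := by
  have hmeas := hX.measurable_survive hS hδ n
  calc μ (stayEvent X S s δ n) ^ 2 = (∫⁻ y, survive π r S δ n y ∂π) ^ 2 := by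
        rw [hX.measure_stayEvent hS hδ]
    _ ≤ ∫⁻ y, survive π r S δ n y * survive π r S δ n y ∂π := by
        simpa only [← sq] using sq_lintegral_le hmeas.aemeasurable
    _ = μ (stayEvent X S s δ (n + n)) := by
        rw [stayEvent_add, hX.measure_inter_eq_of_density (measurableSet_stayEvent_past hS)
            (measurableSet_stayEvent_future hS) hmeas (hX.measure_stayEvent_inter_last hS hδ n),
          hX.setLIntegral_comp_of_density hmeas hmeas (hX.measure_stayEvent_inter_first hS hδ n _)]

lemma pow_measure_stayEvent_le (hX : IsReversibleMarkov X μ π r) (hS : MeasurableSet S)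
    (hδ : 0 < δ) (n j : ℕ) :
    μ (stayEvent X S s δ n) ^ 2 ^ j ≤ μ (stayEvent X S s δ (n * 2 ^ j)) := by
  induction j with
  | zero => simp
  | succ j ih =>
    calc μ (stayEvent X S s δ n) ^ 2 ^ (j + 1) = (μ (stayEvent X S s δ n) ^ 2 ^ j) ^ 2 := by
          rw [← pow_mul, pow_succ]
      _ ≤ μ (stayEvent X S s δ (n * 2 ^ j)) ^ 2 := by gcongr
      _ ≤ μ (stayEvent X S s δ (n * 2 ^ j + n * 2 ^ j)) := hX.sq_measure_stayEvent_le hS hδ _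
      _ = μ (stayEvent X S s δ (n * 2 ^ (j + 1))) := by rw [pow_succ, ← mul_assoc, mul_two]

/-- By right continuity the process stays in `S` for some time `2⁻ᴹ` with positive probability,
and hence, doubling the time `M` times, for a unit of time. -/
lemma stayProb_pos [TopologicalSpace E] [OpensMeasurableSpace E] (hX : IsReversibleMarkov X μ π r)
    (hright : ∀ ω, ContinuousWithinAt (fun t => X t ω) (Set.Ici s) s) (hS : IsOpen S)
    (hπ : π S ≠ 0) : 0 < stayProb π r S := by
  set stay : ℕ → Set Ω := fun M => ⋂ d : ℕ, stayEvent X S s (1 / 2 ^ (M + d)) (2 ^ d)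
  have hSm := hS.measurableSet
  have start_subset : X s ⁻¹' S ⊆ ⋃ M, stay M := fun ω hω =>
    Set.mem_iUnion.2 ((exists_stayEvent_dyadic hS hω (hright ω)).imp fun _ => Set.mem_iInter.2)
  obtain ⟨M, hM⟩ : ∃ M, μ (stay M) ≠ 0 := by
    by_contra! null
    rw [← hX.measure_preimage s hSm] at hπ
    exact hπ (measure_mono_null start_subset (measure_iUnion_null null))
  refine (ENNReal.pow_pos (pos_iff_ne_zero.2 hM) (2 ^ M)).trans_le (le_iInf fun N => ?_)
  rw [← hX.measure_stayEvent hSm (by positivity) s]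
  calc μ (stay M) ^ 2 ^ M ≤ μ (stayEvent X S s (1 / 2 ^ (M + N)) (2 ^ N)) ^ 2 ^ M := by
        gcongr
        exact Set.iInter_subset _ N
    _ ≤ μ (stayEvent X S s (1 / 2 ^ (M + N)) (2 ^ N * 2 ^ M)) :=
        hX.pow_measure_stayEvent_le hSm (by positivity) _ _
    _ = μ (stayEvent X S s (1 / 2 ^ (M + N)) (2 ^ (M + N))) := by rw [← pow_add, add_comm N M]
    _ ≤ μ (stayEvent X S s (1 / 2 ^ N) (2 ^ N)) :=
        measure_mono (stayEvent_dyadic_anti (Nat.le_add_left N M))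

end IsReversibleMarkov

lemma IsReversibleMarkov.stayProb_Ioi_le [MeasurableSpace Ω] {X : ℝ≥0 → Ω → ℝ} {μ : Measure Ω}
    [IsFiniteMeasure μ] {π : Measure ℝ} [SFinite π] {r : ℝ≥0 → ℝ → ℝ → ℝ≥0∞} {b : ℝ}
    (hX : IsReversibleMarkov X μ π r) (hc : ∀ ω, IsCadlag fun t => X t ω) (hb : 0 ≤ b)
    (u : ℝ≥0) : stayProb π r (Set.Ioi 0) ≤ μ (jumpEvent X b u (u + 1))ᶜ := by
  rw [hX.stayProb_eq measurableSet_Ioi u]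
  refine measure_mono fun ω stay jump => ?_
  obtain ⟨n, k, hk, below, -⟩ := (HasJump.eventually_hasGridJump (hc ω) jump).exists
  have pos : 0 < X (u + k * (1 / 2 ^ n)) ω := Set.mem_iInter.1 stay n k hk.le
  have grid_eq : grid u 1 n k = u + k * (1 / 2 ^ n) := by
    unfold grid
    ring
  rw [grid_eq] at below
  linarith

end Stay

/-! ### Mixing without a gap -/

namespace IsReversibleMarkov

variable {Ω : Type*} [MeasurableSpace Ω] {μ : Measure Ω} [IsFiniteMeasure μ] {b b₀ k K : ℝ}
  {s t u v h : ℝ≥0} {G H : Set Ω}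

section Gap

variable {E : Type*} [MeasurableSpace E] {X : ℝ≥0 → Ω → E} {π : Measure E} [SFinite π]
  {r : ℝ≥0 → E → E → ℝ≥0∞}

lemma abs_measureReal_inter_sub_le (hX : IsReversibleMarkov X μ π r) {η : ℝ} (hη : 0 ≤ η)
    (hst : s < t) (hlow : ∀ x y, ENNReal.ofReal (1 - η) ≤ r (t - s) x y)
    (hup : ∀ x y, r (t - s) x y ≤ ENNReal.ofReal (1 + η))
    (hG : MeasurableSet[past X s] G) (hH : MeasurableSet[future X t] H) :
    |μ.real (G ∩ H) - μ.real G * μ.real H| ≤ η * μ.real G * μ.real H := by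
  have upper := hX.measureReal_inter_le hst hG hH (by positivity) fun _ _ _ _ => hup _ _
  have lower := hX.le_measureReal_inter hst hG hH (c := max (1 - η) 0) (le_max_right _ _)
    fun _ _ _ _ => by
      rw [ENNReal.ofReal_max, ENNReal.ofReal_zero, max_eq_left zero_le]
      exact hlow _ _
  have le_max : (1 - η) * μ.real G * μ.real H ≤ max (1 - η) 0 * μ.real G * μ.real H := by
    gcongr
    exact le_max_left _ _
  rw [abs_le]
  constructor <;> linarith

end Gap

variable {X : ℝ≥0 → Ω → ℝ} {π : Measure ℝ} {r : ℝ≥0 → ℝ → ℝ → ℝ≥0∞}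

lemma measureReal_inter_le_of_gap [SFinite π] (hX : IsReversibleMarkov X μ π r)
    (hr : RatioBounds r b₀ k K) (hst : s + 1 / 2 ≤ t) (hG : MeasurableSet[past X s] G)
    (hH : MeasurableSet[future X t] H) :
    μ.real (G ∩ H) ≤ K * μ.real G * μ.real H :=
  hX.measureReal_inter_le ((lt_add_of_pos_right s (by positivity)).trans_le hst) hG hH
    hr.upper_pos.le fun _ _ _ _ => hr.upper _ _ _ (le_tsub_of_add_le_left hst)

lemma mul_tailProd_le_measureReal_jumpEvent [IsFiniteMeasure π] (hX : IsReversibleMarkov X μ π r)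
    (hr : RatioBounds r b₀ k K) (hc : ∀ ω, IsCadlag fun t => X t ω) (hb : b₀ ≤ b)
    (hsmall : K ^ 3 * tailProd π b ≤ k) :
    k / 4 * tailProd π b ≤ μ.real (jumpEvent X b u (u + 1 / 2)) := by
  have lower := hX.le_measureReal_jumpEvent (u := u) (h := 1 / 2) hr hc hb (by positivity)
    (half_le_self zero_le)
  have error_le := mul_le_mul_of_nonneg_right hsmall (tailProd_nonneg π b)
  push_cast at lower
  linarith

lemma measureReal_le_two_mul_measureReal_sdiff_jumpEvent [SFinite π]
    (hX : IsReversibleMarkov X μ π r) (hr : RatioBounds r b₀ k K)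
    (hc : ∀ ω, IsCadlag fun t => X t ω) (hb : b₀ ≤ b) (hh : 0 < h)
    (hsmall : K * h * π.real (Set.Iio (-b)) ≤ 1 / 2) (hH : MeasurableSet[future X (v + h)] H) :
    μ.real H ≤ 2 * μ.real (H \ jumpEvent X b v (v + h)) := by
  have split := measureReal_inter_add_sdiff (μ := μ) (s := H)
    (hX.future_le v _ (measurableSet_jumpEvent_future (X := X) (b := b) hc hh))
  have inter_le := hX.measureReal_jumpEvent_inter_le hr hc hb hh hH
  have half_le := mul_le_mul_of_nonneg_right hsmall (measureReal_nonneg (μ := μ) (s := H))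
  rw [Set.inter_comm] at inter_le
  linarith

lemma measureReal_inter_sdiff_jumpEvent_le [SFinite π] (hX : IsReversibleMarkov X μ π r)
    (hr : RatioBounds r b₀ k K) (hc : ∀ ω, IsCadlag fun t => X t ω) (hb : b₀ ≤ b) (hh : 0 < h)
    (hsmall : K * h * π.real (Set.Iio (-b)) ≤ 1 / 2) (hsv : s + 1 / 2 ≤ v + h)
    (hG : MeasurableSet[past X s] G) (hH : MeasurableSet[future X (v + h)] H) :
    μ.real (G ∩ (H \ jumpEvent X b v (v + h))) ≤
      2 * K * μ.real G * μ.real (H \ jumpEvent X b v (v + h)) :=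
  have hK := hr.upper_pos
  calc μ.real (G ∩ (H \ jumpEvent X b v (v + h))) ≤ μ.real (G ∩ H) :=
        measureReal_mono (Set.inter_subset_inter_right _ Set.sdiff_subset)
    _ ≤ K * μ.real G * μ.real H := hX.measureReal_inter_le_of_gap hr hsv hG hH
    _ ≤ K * μ.real G * (2 * μ.real (H \ jumpEvent X b v (v + h))) := by
        gcongr
        exact hX.measureReal_le_two_mul_measureReal_sdiff_jumpEvent hr hc hb hh hsmall hH
    _ = 2 * K * μ.real G * μ.real (H \ jumpEvent X b v (v + h)) := by ring

variable [IsFiniteMeasure π]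

/-- Two big jumps in adjacent half intervals have a probability of the order of `tailProd π b ^ 2`,
like the product of their probabilities, although there is no gap. -/
lemma measureReal_jumpEvent_inter_jumpEvent_le_mul (hX : IsReversibleMarkov X μ π r)
    (hr : RatioBounds r b₀ k K) (hc : ∀ ω, IsCadlag fun t => X t ω) (hb : b₀ ≤ b)
    (hsmall : K ^ 3 * tailProd π b ≤ k) :
    μ.real (jumpEvent X b u (u + 1 / 2) ∩ jumpEvent X b (u + 1 / 2) (u + 1 / 2 + 1 / 2)) ≤
      4 * K ^ 3 / k ^ 2 * μ.real (jumpEvent X b u (u + 1 / 2)) *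
        μ.real (jumpEvent X b (u + 1 / 2) (u + 1 / 2 + 1 / 2)) := by
  have hK := hr.upper_pos
  have hk := hr.lower_pos
  have hP := tailProd_nonneg π b
  calc _ ≤ K ^ 3 * (1 / 2 : ℝ≥0) * (1 / 2 : ℝ≥0) * tailProd π b ^ 2 :=
        hX.measureReal_jumpEvent_inter_jumpEvent_le hr hc hb (by positivity) le_rfl (by positivity)
    _ = 4 * K ^ 3 / k ^ 2 * (k / 4 * tailProd π b) * (k / 4 * tailProd π b) := by
        push_cast
        field_simp
        ring
    _ ≤ _ := by
        gcongr <;> exact hX.mul_tailProd_le_measureReal_jumpEvent hr hc hb hsmall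

lemma measureReal_jumpEvent_inter_jumpEvent_inter_le (hX : IsReversibleMarkov X μ π r)
    (hr : RatioBounds r b₀ k K) (hc : ∀ ω, IsCadlag fun t => X t ω) (hb : b₀ ≤ b)
    (hsmall : K ^ 3 * tailProd π b ≤ k)
    (hH : MeasurableSet[future X (u + 1 / 2 + 1 / 2 + 1 / 2)] H) :
    μ.real (jumpEvent X b u (u + 1 / 2) ∩
        (jumpEvent X b (u + 1 / 2) (u + 1 / 2 + 1 / 2) ∩ H)) ≤
      8 * K ^ 4 / k ^ 3 * μ.real (jumpEvent X b u (u + 1 / 2)) *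
        μ.real (jumpEvent X b (u + 1 / 2) (u + 1 / 2 + 1 / 2) ∩ H) := by
  have hK := hr.upper_pos
  have hk := hr.lower_pos
  have half_pos : (0 : ℝ≥0) < 1 / 2 := by positivity
  set D₁ := jumpEvent X b u (u + 1 / 2)
  set D₂ := jumpEvent X b (u + 1 / 2) (u + 1 / 2 + 1 / 2)
  have hD₁ : MeasurableSet[past X (u + 1 / 2 + 1 / 2)] D₁ :=
    past_mono le_self_add _ (measurableSet_jumpEvent_past hc half_pos)
  have hD₂ : MeasurableSet[past X (u + 1 / 2 + 1 / 2)] D₂ :=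
    measurableSet_jumpEvent_past hc half_pos
  have lower : k / 2 * μ.real D₂ * μ.real H ≤ μ.real (D₂ ∩ H) := by
    refine hX.le_measureReal_inter (lt_add_of_pos_right _ half_pos) hD₂ hH (by positivity)
      fun _ _ _ _ => ?_
    rw [add_tsub_cancel_left]
    simpa [div_eq_mul_inv] using hr.lower (1 / 2) _ _ (half_le_self zero_le)
  calc μ.real (D₁ ∩ (D₂ ∩ H)) ≤ K * μ.real (D₁ ∩ D₂) * μ.real H := by
        rw [← Set.inter_assoc]
        exact hX.measureReal_inter_le_of_gap hr le_rfl (hD₁.inter hD₂) hH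
    _ ≤ K * (4 * K ^ 3 / k ^ 2 * μ.real D₁ * μ.real D₂) * μ.real H := by
        gcongr
        exact hX.measureReal_jumpEvent_inter_jumpEvent_le_mul hr hc hb hsmall
    _ = 8 * K ^ 4 / k ^ 3 * μ.real D₁ * (k / 2 * μ.real D₂ * μ.real H) := by
        field_simp
        ring
    _ ≤ 8 * K ^ 4 / k ^ 3 * μ.real D₁ * μ.real (D₂ ∩ H) := by gcongr

lemma measureReal_half_inter_inter_jumpEvent_le (hX : IsReversibleMarkov X μ π r)
    (hr : RatioBounds r b₀ k K) (hc : ∀ ω, IsCadlag fun t => X t ω) (hb : b₀ ≤ b)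
    (hsmall : K ^ 3 * tailProd π b ≤ k)
    (hH : MeasurableSet[future X (u + 1 / 2 + 1)] H) :
    μ.real (jumpEvent X b u (u + 1 / 2) ∩ (H ∩ jumpEvent X b (u + 1 / 2) (u + 1 / 2 + 1))) ≤
      (K + 8 * K ^ 4 / k ^ 3) * μ.real (jumpEvent X b u (u + 1 / 2)) *
        μ.real (H ∩ jumpEvent X b (u + 1 / 2) (u + 1 / 2 + 1)) := by
  have hK := hr.upper_pos
  have hk := hr.lower_pos
  have half_pos : (0 : ℝ≥0) < 1 / 2 := by positivity
  have eq_halves : u + 1 / 2 + 1 = u + 1 / 2 + 1 / 2 + 1 / 2 := by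
    rw [add_assoc (u + 1 / 2), add_halves]
  rw [eq_halves] at hH ⊢
  set D₁ := jumpEvent X b u (u + 1 / 2)
  set D₂ := jumpEvent X b (u + 1 / 2) (u + 1 / 2 + 1 / 2)
  set D₃ := jumpEvent X b (u + 1 / 2 + 1 / 2) (u + 1 / 2 + 1 / 2 + 1 / 2)
  rw [jumpEvent_union (v := u + 1 / 2 + 1 / 2) le_self_add le_self_add, Set.inter_comm H]
  have near := hX.measureReal_jumpEvent_inter_jumpEvent_inter_le hr hc hb hsmall hH
  have far : μ.real (D₁ ∩ (D₃ ∩ H)) ≤ K * μ.real D₁ * μ.real (D₃ ∩ H) :=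
    hX.measureReal_inter_le_of_gap hr le_rfl (measurableSet_jumpEvent_past hc half_pos)
      ((measurableSet_jumpEvent_future hc half_pos).inter (future_anti le_self_add _ hH))
  calc μ.real (D₁ ∩ ((D₂ ∪ D₃) ∩ H)) ≤ μ.real (D₁ ∩ (D₂ ∩ H)) + μ.real (D₁ ∩ (D₃ ∩ H)) := by
        rw [Set.union_inter_distrib_right, Set.inter_union_distrib_left]
        exact measureReal_union_le _ _
    _ ≤ 8 * K ^ 4 / k ^ 3 * μ.real D₁ * μ.real (D₂ ∩ H) + K * μ.real D₁ * μ.real (D₃ ∩ H) :=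
        add_le_add near far
    _ ≤ 8 * K ^ 4 / k ^ 3 * μ.real D₁ * μ.real ((D₂ ∪ D₃) ∩ H) +
          K * μ.real D₁ * μ.real ((D₂ ∪ D₃) ∩ H) := by
        gcongr
        exacts [measure_ne_top _ _, Set.subset_union_left, measure_ne_top _ _,
          Set.subset_union_right]
    _ = (K + 8 * K ^ 4 / k ^ 3) * μ.real D₁ * μ.real ((D₂ ∪ D₃) ∩ H) := by ring

lemma measureReal_half_inter_ite_le (hX : IsReversibleMarkov X μ π r)
    (hr : RatioBounds r b₀ k K) (hc : ∀ ω, IsCadlag fun t => X t ω) (hb : b₀ ≤ b)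
    (hsmall : K ^ 3 * tailProd π b ≤ k) (hsmall' : K * π.real (Set.Iio (-b)) ≤ 1 / 2)
    {B₀ B₁ : Set Ω} (hB₀ : MeasurableSet[future X (u + 1 / 2 + 1)] B₀)
    (hB₁ : MeasurableSet[future X (u + 1 / 2 + 1)] B₁) :
    μ.real (jumpEvent X b u (u + 1 / 2) ∩
        (jumpEvent X b (u + 1 / 2) (u + 1 / 2 + 1)).ite B₁ B₀) ≤
      (3 * K + 8 * K ^ 4 / k ^ 3) * μ.real (jumpEvent X b u (u + 1 / 2)) *
        μ.real ((jumpEvent X b (u + 1 / 2) (u + 1 / 2 + 1)).ite B₁ B₀) := by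
  have hK := hr.upper_pos
  have hk := hr.lower_pos
  set J := jumpEvent X b (u + 1 / 2) (u + 1 / 2 + 1)
  set B := J.ite B₁ B₀
  set D := jumpEvent X b u (u + 1 / 2)
  have hD : MeasurableSet[past X (u + 1 / 2)] D := measurableSet_jumpEvent_past hc (by positivity)
  have jump : μ.real (D ∩ (B ∩ J)) ≤ (K + 8 * K ^ 4 / k ^ 3) * μ.real D * μ.real (B ∩ J) := by
    rw [Set.ite_inter_self]
    exact hX.measureReal_half_inter_inter_jumpEvent_le hr hc hb hsmall hB₁
  have no_jump : μ.real (D ∩ (B \ J)) ≤ 2 * K * μ.real D * μ.real (B \ J) := by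
    rw [Set.ite_sdiff_self]
    exact hX.measureReal_inter_sdiff_jumpEvent_le hr hc hb one_pos (by simpa using hsmall')
      (by gcongr; exact half_le_self zero_le) hD hB₀
  calc μ.real (D ∩ B) ≤ μ.real (D ∩ (B ∩ J)) + μ.real (D ∩ (B \ J)) := by
        nth_rw 1 [← Set.inter_union_sdiff B J]
        rw [Set.inter_union_distrib_left]
        exact measureReal_union_le _ _
    _ ≤ (K + 8 * K ^ 4 / k ^ 3) * μ.real D * μ.real B + 2 * K * μ.real D * μ.real B := by
        grw [jump, no_jump]
        gcongr <;> simp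
    _ = (3 * K + 8 * K ^ 4 / k ^ 3) * μ.real D * μ.real B := by ring

/-- Only the second half of the unit interval touches the next one. -/
lemma measureReal_jumpEvent_inter_ite_le (hX : IsReversibleMarkov X μ π r)
    (hr : RatioBounds r b₀ k K) (hc : ∀ ω, IsCadlag fun t => X t ω) (hb : b₀ ≤ b)
    (hsmall : K ^ 3 * tailProd π b ≤ k) (hsmall' : K * π.real (Set.Iio (-b)) ≤ 1 / 2)
    {B₀ B₁ : Set Ω} (hB₀ : MeasurableSet[future X (u + 1 + 1)] B₀)
    (hB₁ : MeasurableSet[future X (u + 1 + 1)] B₁) :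
    μ.real (jumpEvent X b u (u + 1) ∩ (jumpEvent X b (u + 1) (u + 1 + 1)).ite B₁ B₀) ≤
      (4 * K + 8 * K ^ 4 / k ^ 3) * μ.real (jumpEvent X b u (u + 1)) *
        μ.real ((jumpEvent X b (u + 1) (u + 1 + 1)).ite B₁ B₀) := by
  have hK := hr.upper_pos
  have hk := hr.lower_pos
  have eq_halves : u + 1 = u + 1 / 2 + 1 / 2 := by rw [add_assoc, add_halves]
  rw [eq_halves] at hB₀ hB₁ ⊢
  set J := jumpEvent X b (u + 1 / 2 + 1 / 2) (u + 1 / 2 + 1 / 2 + 1)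
  set B := J.ite B₁ B₀
  set D₁ := jumpEvent X b u (u + 1 / 2)
  set D₂ := jumpEvent X b (u + 1 / 2) (u + 1 / 2 + 1 / 2)
  have hB : MeasurableSet[future X (u + 1 / 2 + 1 / 2)] B :=
    MeasurableSet.ite (measurableSet_jumpEvent_future hc one_pos) (future_anti le_self_add _ hB₁)
      (future_anti le_self_add _ hB₀)
  have first : μ.real (D₁ ∩ B) ≤ K * μ.real D₁ * μ.real B :=
    hX.measureReal_inter_le_of_gap hr le_rfl
      (measurableSet_jumpEvent_past hc (by positivity)) hB
  have second : μ.real (D₂ ∩ B) ≤ (3 * K + 8 * K ^ 4 / k ^ 3) * μ.real D₂ * μ.real B :=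
    hX.measureReal_half_inter_ite_le hr hc hb hsmall hsmall' hB₀ hB₁
  rw [jumpEvent_union (v := u + 1 / 2) le_self_add le_self_add]
  calc μ.real ((D₁ ∪ D₂) ∩ B) ≤ μ.real (D₁ ∩ B) + μ.real (D₂ ∩ B) := by
        rw [Set.union_inter_distrib_right]
        exact measureReal_union_le _ _
    _ ≤ K * μ.real (D₁ ∪ D₂) * μ.real B +
        (3 * K + 8 * K ^ 4 / k ^ 3) * μ.real (D₁ ∪ D₂) * μ.real B := by
        grw [first, second]
        gcongr <;> simp
    _ = (4 * K + 8 * K ^ 4 / k ^ 3) * μ.real (D₁ ∪ D₂) * μ.real B := by ring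

end IsReversibleMarkov

/-! ### Conditioning on the jump indicators -/

lemma exists_eq_ite_of_measurableSet_sup {Ω : Type*} {m : MeasurableSpace Ω} {B S : Set Ω}
    (hB : MeasurableSet[MeasurableSpace.generateFrom {S} ⊔ m] B) :
    ∃ B₀ B₁, MeasurableSet[m] B₀ ∧ MeasurableSet[m] B₁ ∧ B = S.ite B₁ B₀ := by
  let split : MeasurableSpace Ω :=
    { MeasurableSet' := fun B => ∃ B₀ B₁, MeasurableSet[m] B₀ ∧ MeasurableSet[m] B₁ ∧
        B = S.ite B₁ B₀
      measurableSet_empty := ⟨∅, ∅, @MeasurableSet.empty _ m, @MeasurableSet.empty _ m, by simp⟩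
      measurableSet_compl := by
        rintro _ ⟨B₀, B₁, h₀, h₁, rfl⟩
        refine ⟨B₀ᶜ, B₁ᶜ, h₀.compl, h₁.compl, ?_⟩
        ext ω
        by_cases hω : ω ∈ S <;> simp [Set.ite, hω]
      measurableSet_iUnion := by
        intro f hf
        choose F₀ F₁ h₀ h₁ hF using hf
        refine ⟨⋃ i, F₀ i, ⋃ i, F₁ i, MeasurableSet.iUnion h₀, MeasurableSet.iUnion h₁, ?_⟩
        ext ω
        by_cases hω : ω ∈ S <;> simp [Set.ite, hω, hF] }
  suffices MeasurableSpace.generateFrom {S} ⊔ m ≤ split from this B hB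
  refine sup_le (MeasurableSpace.generateFrom_le ?_) fun Q hQ => ⟨Q, Q, hQ, hQ, ?_⟩
  · rintro _ rfl
    exact ⟨∅, Set.univ, @MeasurableSet.empty _ m, @MeasurableSet.univ _ m, by simp⟩
  · rw [Set.ite_same]

section Conditioning

variable {Ω : Type*} {m : MeasurableSpace Ω} [m0 : MeasurableSpace Ω] {μ : Measure Ω}
  {B G S : Set Ω} {C η : ℝ}

lemma ae_abs_condExp_sub_le [IsFiniteMeasure μ] (hm : m ≤ m0) (hB : MeasurableSet B)
    (h : ∀ G, MeasurableSet[m] G →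
      |μ.real (G ∩ B) - μ.real G * μ.real B| ≤ η * μ.real G * μ.real B) :
    ∀ᵐ ω ∂μ, |(μ[B.indicator (fun _ => (1 : ℝ)) | m]) ω - μ.real B| ≤ η * μ.real B := by
  set g := μ[B.indicator (fun _ => (1 : ℝ)) | m]
  have hgm : StronglyMeasurable[m] g := stronglyMeasurable_condExp
  have hgi : Integrable g (μ.trim hm) := integrable_condExp.trim hm hgm
  have setIntegral_g : ∀ G, MeasurableSet[m] G → ∫ ω in G, g ω ∂(μ.trim hm) = μ.real (G ∩ B) := by
    intro G hG
    rw [← setIntegral_trim hm hgm hG, setIntegral_condExp hm ((integrable_const _).indicator hB) hG,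
      integral_indicator hB, setIntegral_const, smul_eq_mul, mul_one,
      measureReal_restrict_apply hB, Set.inter_comm]
  have setIntegral_const_trim : ∀ (c : ℝ) G, MeasurableSet[m] G →
      ∫ _ in G, c ∂(μ.trim hm) = μ.real G * c := by
    intro c G hG
    rw [setIntegral_const, smul_eq_mul, measureReal_def, trim_measurableSet_eq hm hG,
      ← measureReal_def]
  have upper : g ≤ᵐ[μ.trim hm] fun _ => (1 + η) * μ.real B := by
    refine ae_le_of_forall_setIntegral_le hgi (integrable_const _) fun G hG _ => ?_
    rw [setIntegral_g G hG, setIntegral_const_trim _ G hG]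
    linarith [(abs_le.1 (h G hG)).2]
  have lower : (fun _ => (1 - η) * μ.real B) ≤ᵐ[μ.trim hm] g := by
    refine ae_le_of_forall_setIntegral_le (integrable_const _) hgi fun G hG _ => ?_
    rw [setIntegral_g G hG, setIntegral_const_trim _ G hG]
    linarith [(abs_le.1 (h G hG)).1]
  filter_upwards [ae_le_of_ae_le_trim upper, ae_le_of_ae_le_trim lower] with ω hupper hlower
  rw [abs_le]
  constructor <;> linarith

lemma abs_measureReal_inter_sub_le_of_generateFrom_singleton [IsProbabilityMeasure μ]
    (hC : 1 ≤ C) (hG : MeasurableSet[MeasurableSpace.generateFrom {S}] G)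
    (h₁ : μ.real (S ∩ B) ≤ C * μ.real S * μ.real B)
    (h₀ : μ.real (Sᶜ ∩ B) ≤ C * μ.real Sᶜ * μ.real B) :
    |μ.real (G ∩ B) - μ.real G * μ.real B| ≤ C * μ.real G * μ.real B := by
  have abs_sub_le : ∀ Q : Set Ω, μ.real (Q ∩ B) ≤ C * μ.real Q * μ.real B →
      |μ.real (Q ∩ B) - μ.real Q * μ.real B| ≤ C * μ.real Q * μ.real B := fun Q hQ => by
    have product_nonneg : 0 ≤ μ.real Q * μ.real B := by positivity
    have product_le := le_mul_of_one_le_left product_nonneg hC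
    have inter_nonneg : 0 ≤ μ.real (Q ∩ B) := measureReal_nonneg
    rw [abs_le]
    constructor <;> linarith
  rcases measurableSet_generateFrom_singleton_iff.1 hG with
    rfl | rfl | rfl | rfl
  · simp
  · exact abs_sub_le _ h₁
  · exact abs_sub_le _ h₀
  · exact abs_sub_le _ (by simpa using le_mul_of_one_le_left measureReal_nonneg hC)

lemma measureReal_inter_le_of_le [IsFiniteMeasure μ] {x : ℝ} (hx : 0 < x) (hS : x ≤ μ.real S)
    (B : Set Ω) : μ.real (S ∩ B) ≤ 1 / x * μ.real S * μ.real B :=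
  calc μ.real (S ∩ B) ≤ 1 * μ.real B := by
        rw [one_mul]
        exact measureReal_mono Set.inter_subset_right
    _ ≤ 1 / x * μ.real S * μ.real B := by
        gcongr
        rwa [one_div_mul_eq_div, one_le_div hx]

end Conditioning

section JumpInd

variable {Ω : Type*} {q ε : ℝ} {X : ℝ≥0 → Ω → ℝ}

lemma jumpInd_succ (q : ℝ) (X : ℝ≥0 → Ω → ℝ) (ε : ℝ) (i : ℕ) :
    jumpInd q X ε (i + 1) = (jumpEvent X (endpt q - ε) i (i + 1)).indicator fun _ => 1 := by
  suffices {ω | 1 ≤ bigJumps q X ε (((i + 1 : ℕ) : ℝ≥0) - 1) (i + 1 : ℕ) ω} =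
      jumpEvent X (endpt q - ε) i (i + 1) by rw [jumpInd, this]
  ext ω
  have pred_eq : ((i + 1 : ℕ) : ℝ≥0) - 1 = i := by
    push_cast
    exact add_tsub_cancel_right _ _
  have neg_level : -(endpt q - ε) = -endpt q + ε := by ring
  rw [Set.mem_ofPred_eq, bigJumps, pred_eq, Set.one_le_encard_iff_nonempty]
  simp only [jumpEvent, HasJump, Set.mem_ofPred_eq, neg_level]
  push_cast
  rfl

lemma comap_jumpInd_le (q : ℝ) (X : ℝ≥0 → Ω → ℝ) (ε : ℝ) (i : ℕ) :
    MeasurableSpace.comap (jumpInd q X ε (i + 1)) inferInstance ≤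
      MeasurableSpace.generateFrom {jumpEvent X (endpt q - ε) i (i + 1)} := by
  rw [jumpInd_succ, ← measurable_iff_comap_le]
  exact Measurable.indicator (@measurable_const _ _ _ (MeasurableSpace.generateFrom _) _)
    (MeasurableSpace.measurableSet_generateFrom rfl)

lemma sigmaOne_le_generateFrom :
    sigmaOne q X ε ≤ MeasurableSpace.generateFrom {jumpEvent X (endpt q - ε) 0 1} := by
  simpa using comap_jumpInd_le q X ε 0

lemma sigmaFrom_le (q : ℝ) (X : ℝ≥0 → Ω → ℝ) (ε : ℝ) (m : ℕ) :
    sigmaFrom q X ε (m + 1) ≤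
      MeasurableSpace.generateFrom {jumpEvent X (endpt q - ε) m (m + 1)} ⊔
        sigmaFrom q X ε (m + 2) := by
  refine iSup₂_le fun i hi => ?_
  rcases (show m + 1 ≤ i from hi).eq_or_lt with rfl | hlt
  · exact le_sup_of_le_left (comap_jumpInd_le q X ε m)
  · exact le_sup_of_le_right
      (le_biSup (fun k => MeasurableSpace.comap (jumpInd q X ε k) inferInstance) hlt)

lemma sigmaOne_le_past (hc : ∀ ω, IsCadlag fun t => X t ω) : sigmaOne q X ε ≤ past X 1 := by
  refine sigmaOne_le_generateFrom.trans (MeasurableSpace.generateFrom_le ?_)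
  rintro _ rfl
  exact zero_add (1 : ℝ≥0) ▸ measurableSet_jumpEvent_past hc one_pos

lemma sigmaFrom_le_future (hc : ∀ ω, IsCadlag fun t => X t ω) (m : ℕ) :
    sigmaFrom q X ε (m + 1) ≤ future X m := by
  refine iSup₂_le fun i hi => ?_
  obtain ⟨j, rfl⟩ := Nat.exists_eq_add_of_le' ((Nat.le_add_left 1 m).trans hi)
  refine (comap_jumpInd_le q X ε j).trans (MeasurableSpace.generateFrom_le ?_)
  rintro _ rfl
  have hmj : (m : ℝ≥0) ≤ j := by exact_mod_cast Nat.le_of_succ_le_succ hi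
  exact future_anti hmj _ (measurableSet_jumpEvent_future hc one_pos)

end JumpInd

/-! ### Constants that depend on `q` alone -/

section Constants

namespace IsReversibleMarkov

variable {Ω : Type*} [MeasurableSpace Ω] {X : ℝ≥0 → Ω → ℝ} {μ : Measure Ω} {π : Measure ℝ}
  {r : ℝ≥0 → ℝ → ℝ → ℝ≥0∞} {b b₀ b₁ k K : ℝ}

lemma measureReal_jumpEvent_inter_le_of_le [IsFiniteMeasure μ] [IsFiniteMeasure π]
    (hX : IsReversibleMarkov X μ π r) (hr : RatioBounds r b₀ k K)
    (hc : ∀ ω, IsCadlag fun t => X t ω) (hb₁ : b₀ ≤ b₁) (hb : b ≤ b₁)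
    (hsmall : K ^ 3 * tailProd π b₁ ≤ k) (hpos : 0 < tailProd π b₁) (u : ℝ≥0) (B : Set Ω) :
    μ.real (jumpEvent X b u (u + 1) ∩ B) ≤
      1 / (k / 4 * tailProd π b₁) * μ.real (jumpEvent X b u (u + 1)) * μ.real B := by
  have hk := hr.lower_pos
  have half_le : u + 1 / 2 ≤ u + 1 := add_le_add_right (half_le_self zero_le) u
  have jump_subset : jumpEvent X b₁ u (u + 1 / 2) ⊆ jumpEvent X b u (u + 1) := by
    rw [jumpEvent_union (le_add_of_nonneg_right zero_le) half_le]
    exact fun ω hω => Or.inl (hω.mono_level hb)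
  exact measureReal_inter_le_of_le (by positivity)
    ((hX.mul_tailProd_le_measureReal_jumpEvent hr hc hb₁ hsmall).trans
      (measureReal_mono jump_subset)) B

lemma measureReal_compl_jumpEvent_inter_le [IsFiniteMeasure μ] [IsProbabilityMeasure π]
    (hX : IsReversibleMarkov X μ π r) (hc : ∀ ω, IsCadlag fun t => X t ω)
    (hπ : π (Set.Ioi 0) ≠ 0) (hb : 0 ≤ b) (u : ℝ≥0) (B : Set Ω) :
    μ.real ((jumpEvent X b u (u + 1))ᶜ ∩ B) ≤
      1 / (stayProb π r (Set.Ioi 0)).toReal * μ.real (jumpEvent X b u (u + 1))ᶜ * μ.real B := by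
  have stay_le := hX.stayProb_Ioi_le hc hb u
  have stay_pos := hX.stayProb_pos (fun ω => (hc ω 0).1) isOpen_Ioi hπ
  exact measureReal_inter_le_of_le
    (ENNReal.toReal_pos stay_pos.ne' (ne_top_of_le_ne_top (measure_ne_top _ _) stay_le))
    (ENNReal.toReal_mono (measure_ne_top _ _) stay_le) B

end IsReversibleMarkov

variable {q : ℝ}

lemma ratioBounds_eratio (hq : q ∈ Set.Ioo (-1 : ℝ) 1) :
    ∃ k K : ℝ, RatioBounds (eratio q) (endpt q / 2) k K := by
  have ha := endpt_pos hq
  obtain ⟨k, hk, lower⟩ := exists_pos_mul_le_ratio hq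
  obtain ⟨K₁, hK₁, upper⟩ := exists_ratio_le hq one_half_pos
  obtain ⟨K₂, -, far⟩ := exists_ratio_le_mul_min_of_far hq
  refine ⟨k, max K₁ K₂, hk, lt_max_of_lt_left hK₁, by positivity, fun δ x y hδ => ?_,
    fun δ x y hδ => ?_, fun δ x y hx hy => ?_⟩ <;> refine ENNReal.ofReal_le_ofReal ?_
  · exact lower δ ⟨δ.coe_nonneg, by exact_mod_cast hδ⟩ _ (clamp_mem hq x) _ (clamp_mem hq y)
  · have half_le : (1 / 2 : ℝ) ≤ δ := by exact_mod_cast hδ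
    exact (upper δ half_le _ (clamp_mem hq x) _ (clamp_mem hq y)).trans (le_max_left _ _)
  · have separated := endpt_le_abs_clamp_sub le_rfl (half_lt_self ha) hx hy
    refine (far δ δ.coe_nonneg _ (clamp_mem hq x) _ (clamp_mem hq y) separated).trans ?_
    push_cast
    gcongr
    exact le_max_right _ _

lemma law_Ioo_pos (hq : q ∈ Set.Ioo (-1 : ℝ) 1) {l u : ℝ} (hl : -endpt q ≤ l) (hlu : l < u)
    (hu : u ≤ endpt q) : 0 < law q (Set.Ioo l u) := by
  have subset_support : Set.Ioo l u ⊆ Function.support fun x => ENNReal.ofReal (dens q x) :=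
    fun x hx => (ENNReal.ofReal_pos.2 (dens_pos hq ⟨hl.trans_lt hx.1, hx.2.trans_le hu⟩)).ne'
  rw [law, withDensity_apply _ measurableSet_Ioo,
    setLIntegral_pos_iff (measurable_dens hq).ennreal_ofReal,
    Set.inter_eq_self_of_subset_right subset_support, Real.volume_Ioo]
  exact ENNReal.ofReal_pos.2 (sub_pos.2 hlu)

lemma exists_forall_law_Iio_le (hq : q ∈ Set.Ioo (-1 : ℝ) 1) [IsProbabilityMeasure (law q)] {η : ℝ}
    (hη : 0 < η) :
    ∃ b₁ ∈ Set.Ico (endpt q / 2) (endpt q), ∀ b ≥ b₁, (law q).real (Set.Iio (-b)) ≤ η := by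
  have ha := endpt_pos hq
  have tendsto_Iio : Tendsto (law q ∘ Set.Iio) (𝓝[>] (-endpt q))
      (𝓝 (law q (⋂ x > -endpt q, Set.Iio x))) :=
    tendsto_measure_biInter_gt (fun _ _ => measurableSet_Iio.nullMeasurableSet)
      (fun _ _ _ hxy => Set.Iio_subset_Iio hxy) ⟨0, neg_neg_iff_pos.2 ha, measure_ne_top _ _⟩
  have null : law q (⋂ x > -endpt q, Set.Iio x) = 0 :=
    measure_mono_null (t := (Set.Ioo (-endpt q) (endpt q))ᶜ)
      (fun y hy mem => lt_irrefl y (Set.mem_iInter₂.1 hy y mem.1)) (law_Ioo_compl hq)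
  rw [null] at tendsto_Iio
  have near : ∀ᶠ x in 𝓝[>] (-endpt q), x ∈ Set.Ioo (-endpt q) (-(endpt q / 2)) :=
    Ioo_mem_nhdsGT (neg_lt_neg (half_lt_self ha))
  obtain ⟨x, small, lower, upper⟩ :=
    ((tendsto_Iio.eventually_lt_const (ENNReal.ofReal_pos.2 hη)).and near).exists
  refine ⟨-x, ⟨by linarith, by linarith⟩, fun b hb => ?_⟩
  exact ENNReal.toReal_le_of_le_ofReal hη.le
    ((measure_mono (Set.Iio_subset_Iio (neg_le.2 hb))).trans small.le)

lemma tailProd_law_pos (hq : q ∈ Set.Ioo (-1 : ℝ) 1) [IsFiniteMeasure (law q)] {b : ℝ}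
    (hb : |b| < endpt q) : 0 < tailProd (law q) b := by
  obtain ⟨hb', hb⟩ := abs_lt.1 hb
  have lower := (law_Ioo_pos hq le_rfl (neg_lt_neg hb) (by linarith)).trans_le
    (measure_mono Set.Ioo_subset_Iio_self)
  have upper := (law_Ioo_pos hq hb'.le hb le_rfl).trans_le (measure_mono Set.Ioo_subset_Ioi_self)
  exact mul_pos (ENNReal.toReal_pos lower.ne' (measure_ne_top _ _))
    (ENNReal.toReal_pos upper.ne' (measure_ne_top _ _))

lemma law_Ioi_zero_ne_zero (hq : q ∈ Set.Ioo (-1 : ℝ) 1) : law q (Set.Ioi 0) ≠ 0 :=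
  have ha := endpt_pos hq
  ((law_Ioo_pos hq (neg_nonpos.2 ha.le) ha le_rfl).trans_le
    (measure_mono Set.Ioo_subset_Ioi_self)).ne'

lemma exists_small_tails (hq : q ∈ Set.Ioo (-1 : ℝ) 1) [IsProbabilityMeasure (law q)] {k K : ℝ}
    (hk : 0 < k) (hK : 0 < K) :
    ∃ b₁, endpt q / 2 ≤ b₁ ∧ 0 < tailProd (law q) b₁ ∧ ∀ b ≥ b₁,
      K ^ 3 * tailProd (law q) b ≤ k ∧ K * (law q).real (Set.Iio (-b)) ≤ 1 / 2 := by
  obtain ⟨b₁, ⟨hb₁, hb₁'⟩, tail_le⟩ := exists_forall_law_Iio_le hq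
    (show 0 < min (k / K ^ 3) (1 / 2 / K) by positivity)
  refine ⟨b₁, hb₁, tailProd_law_pos hq (abs_lt.2 ⟨by linarith [endpt_pos hq], hb₁'⟩),
    fun b hb => ⟨?_, ?_⟩⟩
  · have tailProd_le_tail : tailProd (law q) b ≤ (law q).real (Set.Iio (-b)) :=
      mul_le_of_le_one_right measureReal_nonneg measureReal_le_one
    rw [mul_comm, ← le_div_iff₀ (by positivity)]
    exact tailProd_le_tail.trans ((tail_le b hb).trans (min_le_left _ _))
  · rw [mul_comm, ← le_div_iff₀ hK]
    exact (tail_le b hb).trans (min_le_right _ _)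

lemma exists_measureReal_jumpEvent_inter_le (hq : q ∈ Set.Ioo (-1 : ℝ) 1)
    [IsProbabilityMeasure (law q)] :
    ∃ C : ℝ, ∀ (Ω : Type*) [MeasurableSpace Ω] (μ : Measure Ω) [IsProbabilityMeasure μ]
      (X : ℝ≥0 → Ω → ℝ), IsQOUProcess q X μ → ∀ (ε : ℝ) (B : Set Ω),
      MeasurableSet[sigmaFrom q X ε 2] B →
        μ.real (jumpEvent X (endpt q - ε) 0 1 ∩ B) ≤
          C * μ.real (jumpEvent X (endpt q - ε) 0 1) * μ.real B := by
  obtain ⟨k, K, hr⟩ := ratioBounds_eratio hq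
  have hk := hr.lower_pos
  have hK := hr.upper_pos
  obtain ⟨b₁, hb₁, hpos, small⟩ := exists_small_tails hq hk hK
  refine ⟨max (4 * K + 8 * K ^ 4 / k ^ 3) (1 / (k / 4 * tailProd (law q) b₁)), ?_⟩
  intro Ω _ μ _ X hX ε B hB
  have hX' := hX.isReversibleMarkov hq
  rcases le_total b₁ (endpt q - ε) with hle | hle
  · obtain ⟨B₀, B₁, hB₀, hB₁, rfl⟩ :=
      exists_eq_ite_of_measurableSet_sup (sigmaFrom_le q X ε 1 _ hB)
    have sigma_le : sigmaFrom q X ε 3 ≤ future X (0 + 1 + 1) := by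
      convert sigmaFrom_le_future hX.cadlag 2 using 2
      norm_num
    have mixing := hX'.measureReal_jumpEvent_inter_ite_le hr hX.cadlag (hb₁.trans hle)
      (small _ hle).1 (small _ hle).2 (sigma_le _ hB₀) (sigma_le _ hB₁)
    simp only [zero_add, Nat.cast_one] at mixing ⊢
    refine mixing.trans ?_
    gcongr
    exact le_max_left _ _
  · have mixing := hX'.measureReal_jumpEvent_inter_le_of_le hr hX.cadlag hb₁ hle
      (small _ le_rfl).1 hpos 0 B
    rw [zero_add] at mixing
    refine mixing.trans ?_
    gcongr
    exact le_max_right _ _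

namespace IsQOUProcess

variable {Ω : Type*} [MeasurableSpace Ω] {X : ℝ≥0 → Ω → ℝ} {μ : Measure Ω} {ε : ℝ}
  [IsProbabilityMeasure μ]

lemma abs_measureReal_inter_sub_le (hq : q ∈ Set.Ioo (-1 : ℝ) 1) (hX : IsQOUProcess q X μ)
    {s t : ℝ≥0} (hst : s + 1 ≤ t) {G H : Set Ω} (hG : MeasurableSet[past X s] G)
    (hH : MeasurableSet[future X t] H) :
    |μ.real (G ∩ H) - μ.real G * μ.real H| ≤
      mixConst q * Real.exp (-(t - s : ℝ≥0)) * μ.real G * μ.real H := by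
  have hδ : (1 : ℝ) ≤ (t - s : ℝ≥0) := by exact_mod_cast le_tsub_of_add_le_left hst
  have near_one (x y : ℝ) :
      |clampedRatio q (t - s : ℝ≥0) x y - 1| ≤ mixConst q * Real.exp (-(t - s : ℝ≥0)) :=
    abs_ratio_sub_one_le hq hδ (clamp_mem hq x) (clamp_mem hq y)
  have := hX.isProbabilityMeasure_law
  exact (hX.isReversibleMarkov hq).abs_measureReal_inter_sub_le
    (mul_nonneg (mixConst_nonneg hq) (Real.exp_pos _).le)
    ((lt_add_of_pos_right s one_pos).trans_le hst)
    (fun x y => ENNReal.ofReal_le_ofReal (by linarith [(abs_le.1 (near_one x y)).1]))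
    (fun x y => ENNReal.ofReal_le_ofReal (by linarith [(abs_le.1 (near_one x y)).2])) hG hH

lemma ae_abs_condExp_sub_le_of_two_le (hq : q ∈ Set.Ioo (-1 : ℝ) 1) (hX : IsQOUProcess q X μ)
    {m : ℕ} (hm : 2 ≤ m) {B : Set Ω} (hB : MeasurableSet[sigmaFrom q X ε (m + 1)] B) :
    ∀ᵐ ω ∂μ, |(μ[B.indicator (fun _ => (1 : ℝ)) | sigmaOne q X ε]) ω - μ.real B| ≤
      mixConst q * Real.exp 1 * Real.exp (-(m : ℝ)) * μ.real B := by
  have hX' := hX.isReversibleMarkov hq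
  have hB' := sigmaFrom_le_future hX.cadlag m _ hB
  have two_le : (1 : ℝ≥0) + 1 ≤ m := by
    rw [one_add_one_eq_two]
    exact_mod_cast hm
  have exp_gap : Real.exp (-((m - 1 : ℝ≥0) : ℝ)) = Real.exp 1 * Real.exp (-(m : ℝ)) := by
    rw [← Real.exp_add, NNReal.coe_sub (le_self_add.trans two_le)]
    congr 1
    push_cast
    ring
  refine ae_abs_condExp_sub_le ((sigmaOne_le_past hX.cadlag).trans (hX'.past_le 1))
    (hX'.future_le _ _ hB') fun G hG => ?_
  rw [mul_assoc (mixConst q), ← exp_gap]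
  exact hX.abs_measureReal_inter_sub_le hq two_le (sigmaOne_le_past hX.cadlag _ hG) hB'

end IsQOUProcess

lemma exists_ae_abs_condExp_sub_le (hq : q ∈ Set.Ioo (-1 : ℝ) 1) :
    ∃ C ≥ 0, ∀ (Ω : Type*) [MeasurableSpace Ω] (μ : Measure Ω) [IsProbabilityMeasure μ]
      (X : ℝ≥0 → Ω → ℝ), IsQOUProcess q X μ → ∀ ε ≤ endpt q, ∀ B : Set Ω,
      MeasurableSet[sigmaFrom q X ε 2] B →
        ∀ᵐ ω ∂μ, |(μ[B.indicator (fun _ => (1 : ℝ)) | sigmaOne q X ε]) ω - μ.real B| ≤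
          C * μ.real B := by
  by_cases hlaw : IsProbabilityMeasure (law q)
  · obtain ⟨C, jump_le⟩ := exists_measureReal_jumpEvent_inter_le hq
    set C₀ := 1 / (stayProb (law q) (eratio q) (Set.Ioi 0)).toReal
    refine ⟨max 1 (max C C₀), by positivity, fun Ω _ μ _ X hX ε hε B hB => ?_⟩
    have hX' := hX.isReversibleMarkov hq
    have no_jump_le := hX'.measureReal_compl_jumpEvent_inter_le hX.cadlag
      (law_Ioi_zero_ne_zero hq) (sub_nonneg.2 hε) 0 B
    rw [zero_add] at no_jump_le
    refine ae_abs_condExp_sub_le ((sigmaOne_le_past hX.cadlag).trans (hX'.past_le 1))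
      (hX'.future_le _ _ (sigmaFrom_le_future hX.cadlag 1 _ hB)) fun G hG =>
      abs_measureReal_inter_sub_le_of_generateFrom_singleton (le_max_left _ _)
        (sigmaOne_le_generateFrom _ hG) ?_ ?_
    · refine (jump_le Ω μ X hX ε B hB).trans ?_
      gcongr
      exact (le_max_left _ _).trans (le_max_right _ _)
    · refine no_jump_le.trans ?_
      gcongr
      exact (le_max_right _ _).trans (le_max_right _ _)
  -- A density whose integral is not `1` would belong to no process.
  · exact ⟨0, le_rfl, fun _ _ _ _ _ hX => absurd hX.isProbabilityMeasure_law hlaw⟩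

end Constants

end QOU

end

theorem lemma3p2 (q : ℝ) (hq : q ∈ Set.Ioo (-1 : ℝ) 1) :
    ∃ C : ℝ,
      (∀ t : ℝ, 1 ≤ t → ∀ x ∈ Set.Ioo (-QOU.endpt q) (QOU.endpt q),
        ∀ y ∈ Set.Ioo (-QOU.endpt q) (QOU.endpt q),
          |QOU.transDens q 0 t x y / QOU.dens q y - 1| ≤ C * Real.exp (-t)) ∧
      (∀ (Ω : Type*) [MeasurableSpace Ω] (μ : Measure Ω) [IsProbabilityMeasure μ]
        (X : ℝ≥0 → Ω → ℝ), QOU.IsQOUProcess q X μ →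
        ∀ ε : ℝ, 0 < ε → ∀ m : ℕ, 1 ≤ m → (ε < QOU.endpt q ∨ 2 ≤ m) →
        ∀ B : Set Ω, MeasurableSet[QOU.sigmaFrom q X ε (m + 1)] B →
          ∀ᵐ ω ∂μ, |(μ[B.indicator (fun _ => (1 : ℝ)) | QOU.sigmaOne q X ε]) ω - μ.real B|
            ≤ C * Real.exp (-(m : ℝ)) * μ.real B) := by
  have hM := QOU.mixConst_nonneg hq
  have he : 1 ≤ Real.exp 1 := Real.one_le_exp zero_le_one
  obtain ⟨C₁, hC₁, no_gap⟩ := QOU.exists_ae_abs_condExp_sub_le hq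
  refine ⟨(QOU.mixConst q + C₁) * Real.exp 1, fun t ht x hx y hy => ?_,
    fun Ω _ μ _ X hX ε _ m hm hεm B hB => ?_⟩
  · have density_bound := QOU.abs_transDens_div_dens_sub_one_le hq (ht.trans_eq (sub_zero t).symm)
      (Set.Ioo_subset_Icc_self hx) hy
    rw [sub_zero] at density_bound
    refine density_bound.trans ?_
    gcongr
    exact (le_add_of_nonneg_right hC₁).trans (le_mul_of_one_le_right (by positivity) he)
  · rcases hm.eq_or_lt with rfl | hm2
    · have hε : ε ≤ QOU.endpt q := (hεm.resolve_right (by norm_num)).le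
      filter_upwards [no_gap Ω μ X hX ε hε B hB] with ω hω
      rw [mul_assoc (_ + _), ← Real.exp_add, Nat.cast_one, add_neg_cancel, Real.exp_zero, mul_one]
      exact hω.trans (mul_le_mul_of_nonneg_right (le_add_of_nonneg_left hM) measureReal_nonneg)
    · filter_upwards [hX.ae_abs_condExp_sub_le_of_two_le hq hm2 hB] with ω hω
      refine hω.trans ?_
      gcongr
      exact le_add_of_nonneg_right hC₁
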